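/- Let $S$ be a compact Polish space, and let $V_t(\omega)=\omega(t)$ be the coordinate process on the space of c\`adl\`ag paths $\omega:[0,\infty)\to S$, with its $\sigma$-algebra generated by the evaluations. Let $(\mathbb P_x)_{x\in S}$ be probability measures with $\mathbb P_x(V_0=x)=1$ under which $(V_t)_{t\ge0}$ is a Feller process with respect to a filtration $(\mathcal F_t)_{t\ge 0}$, and put $\mathbb P_\mu=\int_S\mathbb P_y\,\mu(\mathrm dy)$. Assume: (i) $(V_t)$ has a unique invariant probability measure $\pi$; (ii) for each $x\in S$ there are a filtered probability space $(\tilde\Omega,\tilde{\mathcal F},(\tilde{\mathcal F}_t),\tilde{\mathbb P})$ and c\`adl\`ag processes $V^x,V^\pi$ on it, with the laws of $V$ under $\mathbb P_x$ and $\mathbb P_\pi$ respectively, both adapted and Markov with respect to $(\tilde{\mathcal F}_t)$ with the transition probabilities of $V$; (iii) $T^x=\inf\{t\ge0: V^x_t=V^\pi_t\}$ is an $(\tilde{\mathcal F}_t)$-stopping time, and there are constants $C,\delta>0$ with $\sup_{x\in S}\tilde{\mathbb P}(T^x\ge t)\le Ce^{-\delta t}$ for all $t\ge0$. Let $f:\mathbb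 R^K\times S\to\mathbb R$ be continuous and $C^2$ in its first variable $\theta$, with $\nabla_\theta f$ and the Hessian $H_\theta f$ continuous on $\mathbb R^K\times S$ and $\nabla_\theta f(\cdot,y)$ Lipschitz with a constant uniform in $y\in S$. Let $\kappa>0$ be such that $\langle x_1-x_2,\nabla_\theta f(x_1,y)-\nabla_\theta f(x_2,y)\rangle\ge\kappa\|x_1-x_2\|^2$ for all $x_1,x_2\in\mathbb R^K$ and $y\in S$. For $\varepsilon>0$ let $(\theta^\varepsilon_t)_{t\ge0}$ be the solution of $\mathrm d\theta^\varepsilon_t=-\nabla_\theta f(\theta^\varepsilon_t,V_{t/\varepsilon})\,\mathrm dt$ with $\theta^\varepsilon_0=m\in\mathbb R^K$, and let $H^\varepsilon_t(\cdot|m,a)$ and $H^\varepsilon_t(\cdot|m,\pi)$ be the laws of $(\theta^\varepsilon_t,V_{t/\varepsilon})$ under $\mathbb P_a$ ($a\in S$) and $\mathbb P_\pi$. For probability measures $\Pi,\Pi'$ on $\mathbb R^K\times S$ let $$\widetilde{\mathcal W}_{\tilde d}(\Pi,\Pi')=\inf_{\Gamma}\int\tilde d\,\mathrm d\Gamma,\qquad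 \tilde d((u,v),(u',v'))=\mathbf 1_{v\ne v'}+(1\wedge\|u-u'\|)\mathbf 1_{v=v'},$$ the infimum being over all couplings $\Gamma$ of $\Pi$ and $\Pi'$. Then there is a constant $C_f>0$, depending only on $f$, $\kappa$ and $C$, such that for every $0<\varepsilon\le 1\wedge\frac{\delta}{2\kappa}$ the coupled process $(\theta^\varepsilon_t,V_{t/\varepsilon})_{t\ge0}$ has a unique stationary probability measure $\Pi^\varepsilon$ on $\mathbb R^K\times S$, this measure satisfies $\int\|x\|^2\,\Pi^\varepsilon(\mathrm dx,S)<\infty$, and for all $m\in\mathbb R^K$, $a\in S$, $t\ge0$, $$\widetilde{\mathcal W}^2_{\tilde d}(H^\varepsilon_t(\cdot|m,a),\Pi^\varepsilon)\le C_fe^{-\kappa t}\int_{\mathbb R^K}(1+\|x-m\|^2)\,\Pi^\varepsilon(\mathrm dx,S),$$ $$\widetilde{\mathcal W}^2_{\tilde d}(H^\varepsilon_t(\cdot|m,\pi),\Pi^\varepsilon)\le C_fe^{-\kappa t}\int_{\mathbb R^K}\|x-m\|^2\,\Pi^\varepsilon(\mathrm dx,S).$$ -/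

import Mathlib

open MeasureTheory ProbabilityTheory Filter Topology Set
open scoped NNReal ENNReal

universe u w

noncomputable section

/-! ### The index process -/

/-- Right-continuous paths `[0,∞) → S` with left limits
(at time `0` the left-limit condition is void, since `𝓝[<] 0 = ⊥`). -/
def CadlagPath (S : Type u) [TopologicalSpace S] : Type u :=
  {ω : ℝ≥0 → S // ∀ t, ContinuousWithinAt ω (Ici t) t ∧ ∃ l, Tendsto ω (𝓝[<] t) (𝓝 l)}

instance CadlagPath.instCoeFun (S : Type u) [TopologicalSpace S] :
    CoeFun (CadlagPath S) (fun _ => ℝ≥0 → S) := ⟨fun ω => ω.1⟩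

/-- The smallest σ-algebra that makes all evaluations `ω ↦ ω t` measurable. -/
instance CadlagPath.instMeasurableSpace (S : Type u) [TopologicalSpace S] [MeasurableSpace S] :
    MeasurableSpace (CadlagPath S) :=
  ⨆ t : ℝ≥0, MeasurableSpace.comap (fun ω : CadlagPath S => ω t) inferInstance

/-- Under the probability measure `μ`, the process `(X · t)_{t ≥ 0}` with càdlàg paths is adapted to
`ℱ` and has the Markov property with respect to `ℱ` with transition probabilities `Q`:
`μ(X_{s+t} ∈ A | ℱ_s) = Q t X_s A`. -/
def IsMarkovProcess {S : Type u} [TopologicalSpace S] [MeasurableSpace S]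
    (Q : ℝ≥0 → S → Measure S)
    {Ω : Type w} {mΩ : MeasurableSpace Ω} (μ : Measure Ω) (ℱ : Filtration ℝ≥0 mΩ)
    (X : Ω → CadlagPath S) : Prop :=
  Adapted ℱ (fun t ω => X ω t) ∧
  ∀ s t : ℝ≥0, ∀ A : Set S, MeasurableSet A → ∀ B : Set Ω, MeasurableSet[ℱ s] B →
    μ (B ∩ {ω | X ω (s + t) ∈ A}) = ∫⁻ ω in B, Q t (X ω s) A ∂μ

/-- A Feller process on a compact space `S`, realised as the coordinate process `V_t(ω) = ω(t)`
on the space of càdlàg paths, under a family of probability measures `(ℙ_x)_{x ∈ S}`. -/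
structure FellerProcess (S : Type u) [TopologicalSpace S] [MeasurableSpace S] where
  /-- the measures `ℙ_x` -/
  P : Kernel S (CadlagPath S)
  /-- the filtration `(ℱ_t)` -/
  ℱ : Filtration ℝ≥0 (CadlagPath.instMeasurableSpace S)
  prob : ∀ x, IsProbabilityMeasure (P x)
  start : ∀ x, P x {ω | ω 0 = x} = 1
  markov : ∀ x, IsMarkovProcess (fun t y => (P y).map (fun ω => ω t)) (P x) ℱ id
  feller : ∀ (t : ℝ≥0) (h : C(S, ℝ)), Continuous fun x => ∫ ω, h (ω t) ∂(P x)

namespace FellerProcess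

variable {S : Type u} [TopologicalSpace S] [MeasurableSpace S]

/-- The transition probabilities `ℙ_x(V_t ∈ ·)`. -/
def transition (V : FellerProcess S) (t : ℝ≥0) (x : S) : Measure S :=
  (V.P x).map (fun ω => ω t)

/-- `ℙ_μ = ∫ ℙ_y μ(dy)`. -/
def lawFrom (V : FellerProcess S) (μ : Measure S) : Measure (CadlagPath S) :=
  μ.bind V.P

/-- `μ` is an invariant probability measure of the process. -/
def IsInvariant (V : FellerProcess S) (μ : Measure S) : Prop :=
  IsProbabilityMeasure μ ∧
    ∀ (t : ℝ≥0) (A : Set S), MeasurableSet A → ∫⁻ x, V.transition t x A ∂μ = μ A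

/-- `π` is the unique invariant probability measure of the process. -/
def IsUniqueInvariant (V : FellerProcess S) (π : Measure S) : Prop :=
  V.IsInvariant π ∧ ∀ μ : Measure S, V.IsInvariant μ → μ = π

end FellerProcess

/-- The first meeting time `inf {t ≥ 0 | X_t = Y_t}` of two processes (`⊤` if they never meet). -/
def meetingTime {S : Type u} [TopologicalSpace S] {Ω : Type w} (X Y : Ω → CadlagPath S) :
    Ω → WithTop ℝ≥0 :=
  hittingAfter (fun (t : ℝ≥0) ω => (X ω t, Y ω t)) {p : S × S | p.1 = p.2} 0

/-- For every `x`, a version `X` of the process started at `x` and a stationary version `Y`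
live on one filtered probability space, both are Markov with respect to that filtration, their
first meeting time is a stopping time, and it has the tail bound `C e^{-δ t}`. -/
def HasExponentialCoupling {S : Type u} [TopologicalSpace S] [MeasurableSpace S]
    (V : FellerProcess S) (π : Measure S) (C δ : ℝ) : Prop :=
  ∀ x : S, ∃ (Ω : Type w) (mΩ : MeasurableSpace Ω) (μ : Measure Ω) (ℱ : Filtration ℝ≥0 mΩ)
    (X Y : Ω → CadlagPath S),
    IsProbabilityMeasure μ ∧
    IsMarkovProcess V.transition μ ℱ X ∧ IsMarkovProcess V.transition μ ℱ Y ∧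
    μ.map X = V.P x ∧ μ.map Y = V.lawFrom π ∧
    IsStoppingTime ℱ (meetingTime X Y) ∧
    ∀ t : ℝ≥0, μ {ω | (t : WithTop ℝ≥0) ≤ meetingTime X Y ω}
      ≤ ENNReal.ofReal (C * Real.exp (-δ * t))

/-! ### The subsampled targets -/

section Target

variable {K : ℕ} {S : Type u}

/-- `∇_θ f(θ, y)`. -/
def gradTheta (f : EuclideanSpace ℝ (Fin K) → S → ℝ) (x : EuclideanSpace ℝ (Fin K)) (y : S) :
    EuclideanSpace ℝ (Fin K) :=
  gradient (fun x' => f x' y) x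

/-- Regularity of the subsampled targets. Integrability of `f(θ,·)` and `∇_θ f(θ,·)` with respect
to probability measures on `S` is automatic for compact `S`, by continuity. -/
structure IsRegularTarget [TopologicalSpace S] (f : EuclideanSpace ℝ (Fin K) → S → ℝ) : Prop where
  continuous : Continuous fun p : EuclideanSpace ℝ (Fin K) × S => f p.1 p.2
  contDiff : ∀ y, ContDiff ℝ 2 fun x => f x y
  continuous_grad : Continuous fun p : EuclideanSpace ℝ (Fin K) × S => gradTheta f p.1 p.2
  continuous_hess : Continuous fun p : EuclideanSpace ℝ (Fin K) × S =>
    fderiv ℝ (fun x => gradTheta f x p.2) p.1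
  lipschitz_grad : ∃ L : ℝ≥0, ∀ y, LipschitzWith L fun x => gradTheta f x y

/-- `f(·, y)` is `κ`-strongly convex, uniformly in `y`. -/
def IsUniformlyStronglyConvex (f : EuclideanSpace ℝ (Fin K) → S → ℝ) (κ : ℝ) : Prop :=
  ∀ (y : S) (x₁ x₂ : EuclideanSpace ℝ (Fin K)),
    κ * ‖x₁ - x₂‖ ^ 2 ≤ inner ℝ (x₁ - x₂) (gradTheta f x₁ y - gradTheta f x₂ y)

/-! ### The stochastic gradient process with constant learning rate -/

/-- `θ` solves `dθ_t = -∇_θ f(θ_t, ω(t/ε)) dt`, `θ_0 = m`, along the index path `ω`. -/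
def IsSGPC [TopologicalSpace S] (f : EuclideanSpace ℝ (Fin K) → S → ℝ) (ε : ℝ≥0)
    (m : EuclideanSpace ℝ (Fin K)) (ω : CadlagPath S) (θ : ℝ≥0 → EuclideanSpace ℝ (Fin K)) :
    Prop :=
  Continuous θ ∧ ∀ t : ℝ≥0,
    θ t = m - ∫ s in (0 : ℝ)..t, gradTheta f (θ s.toNNReal) (ω (s.toNNReal / ε))

/-- The (unique) solution of the preceding equation. -/
def sgpc [TopologicalSpace S] (f : EuclideanSpace ℝ (Fin K) → S → ℝ) (ε : ℝ≥0)
    (m : EuclideanSpace ℝ (Fin K)) (ω : CadlagPath S) : ℝ≥0 → EuclideanSpace ℝ (Fin K) :=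
  Classical.epsilon (IsSGPC f ε m ω)

/-- The law of `(θ^ε_t, V_{t/ε})` with `θ^ε_0 = m`, when the index path has law `P`. -/
def coupledLaw [TopologicalSpace S] [MeasurableSpace S] (f : EuclideanSpace ℝ (Fin K) → S → ℝ)
    (ε t : ℝ≥0) (m : EuclideanSpace ℝ (Fin K)) (P : Measure (CadlagPath S)) :
    Measure (EuclideanSpace ℝ (Fin K) × S) :=
  P.map fun ω => (sgpc f ε m ω t, ω (t / ε))

/-- `ρ` is a stationary probability measure of the coupled process `(θ^ε_t, V_{t/ε})_{t ≥ 0}`. -/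
def IsStationaryMeasure [TopologicalSpace S] [MeasurableSpace S] (V : FellerProcess S)
    (f : EuclideanSpace ℝ (Fin K) → S → ℝ) (ε : ℝ≥0)
    (ρ : Measure (EuclideanSpace ℝ (Fin K) × S)) : Prop :=
  IsProbabilityMeasure ρ ∧
    ∀ (t : ℝ≥0) (B : Set (EuclideanSpace ℝ (Fin K) × S)), MeasurableSet B →
      ∫⁻ z, coupledLaw f ε t z.1 (V.P z.2) B ∂ρ = ρ B

/-! ### The Wasserstein distance -/

open Classical in
/-- `1_{v ≠ v'} + (1 ∧ ‖u - u'‖) 1_{v = v'}`. -/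
def couplingDist (z z' : EuclideanSpace ℝ (Fin K) × S) : ℝ :=
  if z.2 = z'.2 then min 1 ‖z.1 - z'.1‖ else 1

/-- The Wasserstein distance with cost `couplingDist`. -/
def wassersteinDist [MeasurableSpace S] (ρ ρ' : Measure (EuclideanSpace ℝ (Fin K) × S)) : ℝ≥0∞ :=
  ⨅ (Γ : Measure ((EuclideanSpace ℝ (Fin K) × S) × (EuclideanSpace ℝ (Fin K) × S)))
    (_ : Γ.map Prod.fst = ρ ∧ Γ.map Prod.snd = ρ'),
    ∫⁻ p, ENNReal.ofReal (couplingDist p.1 p.2) ∂Γ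

end Target

end

/-! Two mechanisms drive the result. Along a common index path, strong convexity makes `exp (2κt)
‖θ₁ - θ₂‖²` nonincreasing (`IsSGPC.norm_sub_le`), so the first components contract at rate `κ`. The
same convexity, compared with the point `0`, confines every solution to radius `‖m‖ + R`, uniformly
in time and index path, where `‖∇f(0, ·)‖ ≤ κ R` (`IsSGPC.norm_le`).

Uniqueness: a stationary measure has second marginal `π`, because the index evolves autonomously. By
contraction, its integrals of functions Lipschitz in the first variable are limits of integrals
against the laws started from `δ₀ ⊗ π`. These limits do not depend on the measure, and such
functions separate measures.

Existence: the laws started from `δ₀ ⊗ π` are tight and keep second marginal `π`. Continuity of the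
coupled kernels in the index is not established, so weak convergence alone does not pass through
them. They do preserve boundedness and the Lipschitz property in the first variable, and for
measures with common second marginal `π` such test functions can be replaced by continuous ones
after an approximation in `L¹(π)` (`tendsto_integral_of_snd_eq`). Contraction then makes a limit
point stationary.

Convergence from `π`: start one copy at `m` and the other from the stationary measure, with one
index path for both. Convergence from `(m, a)`: split `[0, t]` in half. The index coupling gives, at
half time, a coupling of the index laws that disagrees with probability at most `C exp (-κt/2)`.
Since `X` and `Y` are only separately Markov, this needs the strong Markov property at the meeting
time; it is proved for time averages of the semigroup, which are Lipschitz in time, and transferred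
by a limit (`map_restrict_meetingTime_le`). The coupling is lifted to the full states
(`exists_coupling_over`), whose first components are within `‖m‖ + 2R`. In the second half, equal
indices share a path and the contraction acts (`wassersteinDist_bind_le`). -/

set_option linter.unusedSectionVars false

/-! ### Càdlàg paths: measurability, stopping and shifting -/

namespace CadlagPath

variable {S : Type u} [TopologicalSpace S]

lemma continuousWithinAt_Ici (ω : CadlagPath S) (t : ℝ≥0) : ContinuousWithinAt ω (Ici t) t :=
  (ω.2 t).1

lemma exists_left_limit (ω : CadlagPath S) (t : ℝ≥0) : ∃ l, Tendsto ω (𝓝[<] t) (𝓝 l) :=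
  (ω.2 t).2

/-- The path `r ↦ ω (s + r)`. -/
def shift (s : ℝ≥0) (ω : CadlagPath S) : CadlagPath S :=
  ⟨fun r => ω (s + r), fun t => by
    refine ⟨?_, ?_⟩
    · refine (ω.continuousWithinAt_Ici (s + t)).comp (t := Ici (s + t))
        (by fun_prop : Continuous fun r : ℝ≥0 => s + r).continuousWithinAt ?_
      intro r hr
      simpa using hr
    · obtain ⟨l, hl⟩ := ω.exists_left_limit (s + t)
      refine ⟨l, hl.comp ?_⟩
      refine tendsto_nhdsWithin_of_tendsto_nhds_of_eventually_within _
        ((by fun_prop : Continuous fun r : ℝ≥0 => s + r).continuousWithinAt) ?_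
      filter_upwards [self_mem_nhdsWithin] with r hr
      simpa using hr⟩

/-- The path stopped at time `s`. -/
def stopAt (s : ℝ≥0) (ω : CadlagPath S) : CadlagPath S :=
  ⟨fun r => ω (min r s), fun t => by
    have hc : Continuous fun r : ℝ≥0 => min r s := by fun_prop
    refine ⟨?_, ?_⟩
    · refine (ω.continuousWithinAt_Ici (min t s)).comp (t := Ici (min t s))
        hc.continuousWithinAt ?_
      intro r hr
      exact min_le_min_right s (mem_Ici.1 hr)
    · rcases le_or_gt t s with h | h
      · obtain ⟨l, hl⟩ := ω.exists_left_limit t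
        refine ⟨l, hl.congr' ?_⟩
        filter_upwards [self_mem_nhdsWithin] with r hr
        rw [min_eq_left ((le_of_lt hr).trans h)]
      · refine ⟨ω s, tendsto_const_nhds.congr' ?_⟩
        filter_upwards [nhdsWithin_le_nhds (lt_mem_nhds h)] with r hr
        rw [min_eq_right hr.le]⟩

@[simp] lemma shift_apply (s r : ℝ≥0) (ω : CadlagPath S) : shift s ω r = ω (s + r) := rfl

@[simp] lemma stopAt_apply (s r : ℝ≥0) (ω : CadlagPath S) : stopAt s ω r = ω (min r s) := rfl

variable [MeasurableSpace S]

lemma measurable_eval (t : ℝ≥0) : Measurable fun ω : CadlagPath S => ω t := by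
  have h : MeasurableSpace.comap (fun ω : CadlagPath S => ω t) inferInstance ≤
      CadlagPath.instMeasurableSpace S := le_iSup (fun t : ℝ≥0 =>
        MeasurableSpace.comap (fun ω : CadlagPath S => ω t) inferInstance) t
  exact (comap_measurable _).mono h le_rfl

lemma measurable_of_eval {Ω : Type*} {m : MeasurableSpace Ω} {X : Ω → CadlagPath S}
    (h : ∀ t, Measurable fun ω => X ω t) : Measurable X := by
  refine Measurable.of_le_map ?_
  refine iSup_le fun t => ?_
  rw [MeasurableSpace.comap_le_iff_le_map]
  exact (h t).le_map

lemma measurable_shift (s : ℝ≥0) : Measurable (shift (S := S) s) :=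
  measurable_of_eval fun t => measurable_eval (s + t)

/-- Right continuity makes evaluation the pointwise limit of evaluations at times rounded up to a
grid, and each of these involves only countably many times. -/
lemma measurable_uncurry [TopologicalSpace.PseudoMetrizableSpace S] [BorelSpace S] :
    Measurable fun p : CadlagPath S × ℝ≥0 => p.1 p.2 := by
  let d : ℕ → ℝ≥0 → ℝ≥0 := fun n t => (⌊(n + 1 : ℝ≥0) * t⌋₊ + 1 : ℝ≥0) / (n + 1)
  have hd : ∀ t, Tendsto (fun n => d n t) atTop (𝓝[≥] t) := by
    intro t
    refine tendsto_nhdsWithin_of_tendsto_nhds_of_eventually_within _ ?_ (Eventually.of_forall ?_)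
    · have h1 : Tendsto (fun n : ℕ => t + 1 / ((n : ℝ≥0) + 1)) atTop (𝓝 (t + 0)) :=
        tendsto_const_nhds.add tendsto_one_div_add_atTop_nhds_zero_nat
      rw [add_zero] at h1
      refine tendsto_of_tendsto_of_tendsto_of_le_of_le tendsto_const_nhds h1 ?_ ?_
      · intro n
        have := (Nat.lt_floor_add_one ((n + 1 : ℝ≥0) * t)).le
        simp only [d]
        rw [le_div_iff₀ (by positivity)]
        linarith [mul_comm t (n + 1 : ℝ≥0)]
      · intro n
        have := Nat.floor_le (zero_le (a := (n + 1 : ℝ≥0) * t))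
        simp only [d]
        rw [add_div]
        gcongr
        rw [div_le_iff₀ (by positivity)]
        linarith [mul_comm t (n + 1 : ℝ≥0)]
    · intro n
      have := (Nat.lt_floor_add_one ((n + 1 : ℝ≥0) * t)).le
      simp only [d, mem_Ici]
      rw [le_div_iff₀ (by positivity)]
      linarith [mul_comm t (n + 1 : ℝ≥0)]
  refine measurable_of_tendsto_metrizable (f := fun n (p : CadlagPath S × ℝ≥0) => p.1 (d n p.2))
    (fun n => ?_) ?_
  · have hm : Measurable fun p : CadlagPath S × ℕ => p.1 ((p.2 + 1 : ℝ≥0) / (n + 1)) :=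
      measurable_from_prod_countable_left fun k =>
        measurable_eval ((k + 1 : ℝ≥0) / (n + 1))
    exact hm.comp (measurable_fst.prodMk
      (Nat.measurable_floor.comp (measurable_const.mul measurable_snd)))
  · rw [tendsto_pi_nhds]
    intro p
    exact (p.1.continuousWithinAt_Ici p.2).tendsto.comp (hd p.2)

end CadlagPath

/-! ### The stochastic gradient process along a fixed index path -/

section Flow

variable {K : ℕ} {S : Type u} [TopologicalSpace S] {f : EuclideanSpace ℝ (Fin K) → S → ℝ}

/-- The integrand `∇_θ f(θ_s, ω(s/ε))`. -/
noncomputable def drift (f : EuclideanSpace ℝ (Fin K) → S → ℝ) (ε : ℝ≥0) (ω : CadlagPath S)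
    (θ : ℝ≥0 → EuclideanSpace ℝ (Fin K)) (s : ℝ) : EuclideanSpace ℝ (Fin K) :=
  gradTheta f (θ s.toNNReal) (ω (s.toNNReal / ε))

lemma IsRegularTarget.exists_norm_grad_le [CompactSpace S] (hf : IsRegularTarget f)
    (x : EuclideanSpace ℝ (Fin K)) : ∃ M, 0 ≤ M ∧ ∀ y, ‖gradTheta f x y‖ ≤ M := by
  obtain ⟨M, hM⟩ := isCompact_univ.exists_bound_of_continuousOn
    (f := fun y : S => gradTheta f x y)
    (hf.continuous_grad.comp (Continuous.prodMk_right x)).continuousOn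
  exact ⟨max M 0, le_max_right _ _, fun y => (hM y (mem_univ y)).trans (le_max_left _ _)⟩

/-- The normalisation `1 ≤ L` lets the factor `t` in the initial Picard estimate be absorbed into
`exp (2 * L * t)`. -/
lemma IsRegularTarget.exists_lipschitz (hf : IsRegularTarget f) :
    ∃ L : ℝ, 1 ≤ L ∧ ∀ x x' y, ‖gradTheta f x y - gradTheta f x' y‖ ≤ L * ‖x - x'‖ := by
  obtain ⟨L, hL⟩ := hf.lipschitz_grad
  refine ⟨L + 1, by simp, fun x x' y => ?_⟩
  have h := (hL y).dist_le_mul x x'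
  rw [dist_eq_norm, dist_eq_norm] at h
  refine h.trans ?_
  gcongr
  simp

lemma drift_continuousWithinAt (hf : IsRegularTarget f) (ε : ℝ≥0) (ω : CadlagPath S)
    {θ : ℝ≥0 → EuclideanSpace ℝ (Fin K)} (hθ : Continuous θ) (t : ℝ) :
    ContinuousWithinAt (drift f ε ω θ) (Ici t) t := by
  have h1 : Continuous fun s : ℝ => θ s.toNNReal := by fun_prop
  have h2 : Continuous fun s : ℝ => s.toNNReal / ε := by fun_prop
  have h3 : ContinuousWithinAt (fun s : ℝ => ω (s.toNNReal / ε)) (Ici t) t := by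
    refine ContinuousWithinAt.comp (t := Ici (t.toNNReal / ε)) (f := fun s : ℝ => s.toNNReal / ε)
      (ω.continuousWithinAt_Ici (t.toNNReal / ε)) h2.continuousWithinAt ?_
    intro s hs
    rw [mem_Ici] at hs
    change t.toNNReal / ε ≤ s.toNNReal / ε
    gcongr
  exact (hf.continuous_grad.tendsto (θ t.toNNReal, ω (t.toNNReal / ε))).comp
    (h1.continuousWithinAt.prodMk_nhds h3)

variable [PolishSpace S] [CompactSpace S] [MeasurableSpace S] [BorelSpace S]

lemma IsRegularTarget.measurable_grad (hf : IsRegularTarget f) :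
    Measurable fun p : EuclideanSpace ℝ (Fin K) × S => gradTheta f p.1 p.2 :=
  hf.continuous_grad.measurable

lemma drift_measurable (hf : IsRegularTarget f) (ε : ℝ≥0) (ω : CadlagPath S)
    {θ : ℝ≥0 → EuclideanSpace ℝ (Fin K)} (hθ : Measurable θ) : Measurable (drift f ε ω θ) := by
  have h1 : Measurable fun s : ℝ => θ s.toNNReal := hθ.comp measurable_real_toNNReal
  have h2 : Measurable fun s : ℝ => ω (s.toNNReal / ε) :=
    CadlagPath.measurable_uncurry.comp
      (measurable_const.prodMk (measurable_real_toNNReal.div_const ε))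
  exact hf.measurable_grad.comp (h1.prodMk h2)

/-- Measurability and local boundedness are the right hypotheses here: the limit of the Picard
iterates has these properties before its continuity is known. -/
lemma drift_intervalIntegrable (hf : IsRegularTarget f) (ε : ℝ≥0) (ω : CadlagPath S)
    {θ : ℝ≥0 → EuclideanSpace ℝ (Fin K)} (hθ : Measurable θ)
    (hb : ∀ t, ∃ b, ∀ s ≤ t, ‖θ s‖ ≤ b) (p q : ℝ) :
    IntervalIntegrable (drift f ε ω θ) volume p q := by
  obtain ⟨M, hM0, hM⟩ := hf.exists_norm_grad_le 0
  obtain ⟨L, hL1, hL⟩ := hf.exists_lipschitz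
  obtain ⟨b, hb⟩ := hb (max p q).toNNReal
  rw [intervalIntegrable_iff]
  refine Measure.integrableOn_of_bounded (M := M + L * b) (by simp)
    (drift_measurable hf ε ω hθ).aestronglyMeasurable ?_
  filter_upwards [ae_restrict_mem measurableSet_uIoc] with s hs
  have hs' : s ≤ max p q := hs.2
  have h1 := hL (θ s.toNNReal) 0 (ω (s.toNNReal / ε))
  have h2 := hM (ω (s.toNNReal / ε))
  have h3 := hb s.toNNReal (Real.toNNReal_le_toNNReal hs')
  calc ‖drift f ε ω θ s‖ = ‖gradTheta f 0 (ω (s.toNNReal / ε)) +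
        (gradTheta f (θ s.toNNReal) (ω (s.toNNReal / ε)) -
          gradTheta f 0 (ω (s.toNNReal / ε)))‖ := by simp [drift]
    _ ≤ M + L * ‖θ s.toNNReal - 0‖ := (norm_add_le _ _).trans (add_le_add h2 h1)
    _ ≤ M + L * b := by rw [sub_zero]; gcongr

lemma exists_norm_le_of_continuous {E : Type*} [NormedAddCommGroup E] {θ : ℝ≥0 → E}
    (hθ : Continuous θ) (t : ℝ≥0) : ∃ b, ∀ s ≤ t, ‖θ s‖ ≤ b := by
  obtain ⟨b, hb⟩ := (isCompact_Icc (a := (0 : ℝ≥0)) (b := t)).exists_bound_of_continuousOn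
    hθ.continuousOn
  exact ⟨b, fun s hs => hb s ⟨zero_le, hs⟩⟩

lemma drift_intervalIntegrable_of_continuous (hf : IsRegularTarget f) (ε : ℝ≥0)
    (ω : CadlagPath S) {θ : ℝ≥0 → EuclideanSpace ℝ (Fin K)} (hθ : Continuous θ) (p q : ℝ) :
    IntervalIntegrable (drift f ε ω θ) volume p q :=
  drift_intervalIntegrable hf ε ω hθ.measurable (exists_norm_le_of_continuous hθ) p q

/-! #### Picard iteration -/

/-- The Picard iterates of the equation `dθ_t = -∇_θ f(θ_t, ω(t/ε)) dt`, `θ_0 = m`. -/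
noncomputable def picard (f : EuclideanSpace ℝ (Fin K) → S → ℝ) (ε : ℝ≥0)
    (m : EuclideanSpace ℝ (Fin K)) (ω : CadlagPath S) :
    ℕ → ℝ≥0 → EuclideanSpace ℝ (Fin K)
  | 0 => fun _ => m
  | n + 1 => fun t => m - ∫ s in (0 : ℝ)..t, drift f ε ω (picard f ε m ω n) s

lemma continuous_picard (hf : IsRegularTarget f) (ε : ℝ≥0) (m : EuclideanSpace ℝ (Fin K))
    (ω : CadlagPath S) (n : ℕ) : Continuous (picard f ε m ω n) := by
  induction n with
  | zero => exact continuous_const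
  | succ n ih =>
    have h := intervalIntegral.continuous_primitive (μ := volume)
      (drift_intervalIntegrable_of_continuous hf ε ω ih) 0
    exact continuous_const.sub (h.comp NNReal.continuous_coe)

/-- Joint measurability in the initial value, the path and the time is inherited by the limit, and
through it by the solution map, whose definition by choice reveals nothing about measurability. -/
lemma measurable_picard (hf : IsRegularTarget f) (ε : ℝ≥0) (n : ℕ) :
    Measurable fun p : (EuclideanSpace ℝ (Fin K) × CadlagPath S) × ℝ≥0 =>
      picard f ε p.1.1 p.1.2 n p.2 := by
  induction n with
  | zero => exact measurable_fst.comp measurable_fst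
  | succ n ih =>
    let X := (EuclideanSpace ℝ (Fin K) × CadlagPath S) × ℝ≥0
    have h1 : Measurable fun q : X × ℝ =>
        drift f ε q.1.1.2 (picard f ε q.1.1.1 q.1.1.2 n) q.2 := by
      have e1 : Measurable fun q : X × ℝ => picard f ε q.1.1.1 q.1.1.2 n q.2.toNNReal :=
        ih.comp ((measurable_fst.comp measurable_fst).prodMk
          (measurable_real_toNNReal.comp measurable_snd))
      have e2 : Measurable fun q : X × ℝ => q.1.1.2 (q.2.toNNReal / ε) :=
        CadlagPath.measurable_uncurry.comp
          ((measurable_snd.comp (measurable_fst.comp measurable_fst)).prodMk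
            ((measurable_real_toNNReal.comp measurable_snd).div_const ε))
      exact hf.measurable_grad.comp (e1.prodMk e2)
    -- The indicator of `0 < s ≤ t` turns an integral with variable endpoint into one over all of
    -- `ℝ`, to which measurability of parameter integrals applies.
    have hset : MeasurableSet {q : X × ℝ | 0 < q.2 ∧ q.2 ≤ (q.1.2 : ℝ)} := by
      refine (measurableSet_lt measurable_const measurable_snd).inter
        (measurableSet_le measurable_snd ?_)
      exact measurable_coe_nnreal_real.comp (measurable_snd.comp measurable_fst)
    have h2 : StronglyMeasurable (Function.uncurry fun (p : X) (s : ℝ) =>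
        {q : X × ℝ | 0 < q.2 ∧ q.2 ≤ (q.1.2 : ℝ)}.indicator
          (fun q => drift f ε q.1.1.2 (picard f ε q.1.1.1 q.1.1.2 n) q.2) (p, s)) :=
      (h1.indicator hset).stronglyMeasurable
    have h3 := (h2.integral_prod_right (ν := (volume : Measure ℝ))).measurable
    convert (measurable_fst.comp measurable_fst).sub h3 using 1
    funext p
    have hp : (0 : ℝ) ≤ p.2 := p.2.coe_nonneg
    simp only [picard, Pi.sub_apply, Function.comp_apply]
    rw [intervalIntegral.integral_of_le hp, ← integral_indicator measurableSet_Ioc]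
    rfl

/-- The weight `exp (2 * L * t)` makes the Picard map a contraction by `1/2` on the whole half-line:
integrating `L exp (2Ls)` returns at most half of the weight, so no patching of short time intervals
is needed. -/
lemma norm_picard_sub_le (hf : IsRegularTarget f) {L : ℝ} (hL1 : 1 ≤ L)
    (hL : ∀ x x' y, ‖gradTheta f x y - gradTheta f x' y‖ ≤ L * ‖x - x'‖)
    {m : EuclideanSpace ℝ (Fin K)} {D : ℝ} (hD0 : 0 ≤ D) (hD : ∀ y, ‖gradTheta f m y‖ ≤ D)
    (ε : ℝ≥0) (ω : CadlagPath S) (n : ℕ) (t : ℝ≥0) :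
    ‖picard f ε m ω n t - picard f ε m ω (n + 1) t‖ ≤
      D * Real.exp (2 * L * t) * (1 / 2) ^ n := by
  induction n generalizing t with
  | zero =>
    have h := intervalIntegral.norm_integral_le_of_norm_le_const (a := (0 : ℝ)) (b := t)
      (f := drift f ε ω (fun _ => m)) (C := D) (fun s _ => hD _)
    have h2 : (t : ℝ) ≤ Real.exp (2 * L * t) := by
      have := Real.add_one_le_exp (2 * L * (t : ℝ))
      nlinarith [t.coe_nonneg]
    simp only [picard, sub_sub_cancel, pow_zero, mul_one]
    refine h.trans ?_
    rw [sub_zero, abs_of_nonneg t.coe_nonneg]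
    gcongr
  | succ n ih =>
    have e : picard f ε m ω (n + 1) t - picard f ε m ω (n + 1 + 1) t =
        ∫ s in (0 : ℝ)..t, (drift f ε ω (picard f ε m ω (n + 1)) s -
          drift f ε ω (picard f ε m ω n) s) := by
      rw [intervalIntegral.integral_sub
        (drift_intervalIntegrable_of_continuous hf ε ω (continuous_picard hf ε m ω _) _ _)
        (drift_intervalIntegrable_of_continuous hf ε ω (continuous_picard hf ε m ω _) _ _)]
      simp [picard]
    have hder : ∀ s : ℝ, HasDerivAt (fun s => D * (1 / 2) ^ n * Real.exp (2 * L * s) / 2)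
        (L * (D * Real.exp (2 * L * s) * (1 / 2) ^ n)) s := by
      intro s
      have h1 : HasDerivAt (fun s : ℝ => 2 * L * s) (2 * L) s := by
        simpa using (hasDerivAt_id s).const_mul (2 * L)
      refine ((h1.exp.const_mul (D * (1 / 2) ^ n)).div_const 2).congr_deriv ?_
      ring
    have hint := intervalIntegral.integral_eq_sub_of_hasDerivAt (a := (0 : ℝ)) (b := t)
      (fun s _ => hder s) (Continuous.intervalIntegrable (by fun_prop) _ _)
    rw [e]
    refine (intervalIntegral.norm_integral_le_of_norm_le (g := fun s =>
      L * (D * Real.exp (2 * L * s) * (1 / 2) ^ n)) t.coe_nonneg ?_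
      (Continuous.intervalIntegrable (by fun_prop) _ _)).trans ?_
    · refine Eventually.of_forall fun s hs => ?_
      refine (hL _ _ _).trans ?_
      rw [norm_sub_rev]
      have := ih s.toNNReal
      rw [Real.coe_toNNReal s hs.1.le] at this
      gcongr
    · rw [hint]
      have : 0 ≤ D * (1 / 2 : ℝ) ^ n := by positivity
      rw [pow_succ]
      simp only [mul_zero, Real.exp_zero]
      nlinarith

theorem exists_isSGPC_tendsto_picard (hf : IsRegularTarget f) (ε : ℝ≥0)
    (m : EuclideanSpace ℝ (Fin K)) (ω : CadlagPath S) :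
    ∃ θ, IsSGPC f ε m ω θ ∧
      ∀ t, Tendsto (fun n => picard f ε m ω n t) atTop (𝓝 (θ t)) := by
  obtain ⟨D, hD0, hD⟩ := hf.exists_norm_grad_le m
  obtain ⟨L, hL1, hL⟩ := hf.exists_lipschitz
  have hstep := norm_picard_sub_le hf hL1 hL hD0 hD ε ω
  have hdist : ∀ t n, dist (picard f ε m ω n t) (picard f ε m ω (n + 1) t) ≤
      D * Real.exp (2 * L * t) * (1 / 2) ^ n := fun t n => by
    rw [dist_eq_norm]; exact hstep n t
  have hlim : ∀ t, ∃ x, Tendsto (fun n => picard f ε m ω n t) atTop (𝓝 x) := fun t =>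
    cauchySeq_tendsto_of_complete (cauchySeq_of_le_geometric _ _ (by norm_num) (hdist t))
  choose θ hθ using hlim
  have hclose : ∀ n t, ‖picard f ε m ω n t - θ t‖ ≤
      2 * D * Real.exp (2 * L * t) * (1 / 2) ^ n := by
    intro n t
    have := dist_le_of_le_geometric_of_tendsto (1 / 2) _ (by norm_num) (hdist t) (hθ t) n
    rw [dist_eq_norm] at this
    refine this.trans (le_of_eq ?_)
    ring
  have hmeas : Measurable θ := by
    refine measurable_of_tendsto_metrizable
      (fun n => (continuous_picard hf ε m ω n).measurable) ?_
    rw [tendsto_pi_nhds]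
    exact hθ
  have hbdd : ∀ t, ∃ b, ∀ s ≤ t, ‖θ s‖ ≤ b := by
    intro t
    refine ⟨‖m‖ + 2 * D * Real.exp (2 * L * t), fun s hs => ?_⟩
    have h1 := hclose 0 s
    simp only [picard, pow_zero, mul_one] at h1
    have h2 : ‖θ s‖ ≤ ‖m‖ + ‖m - θ s‖ := by
      calc ‖θ s‖ = ‖m - (m - θ s)‖ := by simp
        _ ≤ _ := norm_sub_le _ _
    have h3 : Real.exp (2 * L * s) ≤ Real.exp (2 * L * t) := by
      gcongr
    nlinarith
  have hII := drift_intervalIntegrable hf ε ω hmeas hbdd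
  have heq : ∀ t : ℝ≥0, θ t = m - ∫ s in (0 : ℝ)..t, drift f ε ω θ s := by
    intro t
    refine tendsto_nhds_unique ((hθ t).comp (tendsto_add_atTop_nat 1)) ?_
    have hb : ∀ n : ℕ, ‖picard f ε m ω (n + 1) t - (m - ∫ s in (0 : ℝ)..t, drift f ε ω θ s)‖ ≤
        L * (2 * D * Real.exp (2 * L * t)) * t * (1 / 2) ^ n := by
      intro n
      have e : picard f ε m ω (n + 1) t - (m - ∫ s in (0 : ℝ)..t, drift f ε ω θ s) =
          ∫ s in (0 : ℝ)..t, (drift f ε ω θ s - drift f ε ω (picard f ε m ω n) s) := by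
        rw [intervalIntegral.integral_sub (hII _ _)
          (drift_intervalIntegrable_of_continuous hf ε ω (continuous_picard hf ε m ω _) _ _)]
        simp [picard]
      rw [e]
      have := intervalIntegral.norm_integral_le_of_norm_le_const (a := (0 : ℝ)) (b := t)
        (f := fun s => drift f ε ω θ s - drift f ε ω (picard f ε m ω n) s)
        (C := L * (2 * D * Real.exp (2 * L * t) * (1 / 2) ^ n)) ?_
      · refine this.trans (le_of_eq ?_)
        rw [sub_zero, abs_of_nonneg t.coe_nonneg]
        ring
      · intro s hs
        rw [uIoc_of_le t.coe_nonneg] at hs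
        refine (hL _ _ _).trans ?_
        rw [norm_sub_rev]
        have h1 := hclose n s.toNNReal
        rw [Real.coe_toNNReal s hs.1.le] at h1
        have h2 : s ≤ t := hs.2
        refine mul_le_mul_of_nonneg_left (h1.trans ?_) (by linarith)
        gcongr
    rw [tendsto_iff_norm_sub_tendsto_zero]
    refine squeeze_zero (fun _ => norm_nonneg _) hb ?_
    have := (tendsto_pow_atTop_nhds_zero_of_lt_one (r := (1 / 2 : ℝ)) (by norm_num)
      (by norm_num)).const_mul (L * (2 * D * Real.exp (2 * L * t)) * t)
    simpa using this
  refine ⟨θ, ⟨?_, heq⟩, hθ⟩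
  rw [funext heq]
  exact continuous_const.sub
    ((intervalIntegral.continuous_primitive (μ := volume) hII 0).comp NNReal.continuous_coe)

/-! #### Contraction and growth -/

/-- Only right derivatives are available, since the index path may jump; they suffice for the
one-sided comparison theorem used in the next two estimates. -/
lemma IsSGPC.hasDerivWithinAt (hf : IsRegularTarget f) {ε : ℝ≥0}
    {m : EuclideanSpace ℝ (Fin K)} {ω : CadlagPath S} {θ : ℝ≥0 → EuclideanSpace ℝ (Fin K)}
    (h : IsSGPC f ε m ω θ) {t : ℝ} (ht : 0 ≤ t) :
    HasDerivWithinAt (fun s : ℝ => θ s.toNNReal) (-drift f ε ω θ t) (Ici t) t := by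
  have h1 : HasDerivWithinAt (fun u => ∫ s in (0 : ℝ)..u, drift f ε ω θ s) (drift f ε ω θ t)
      (Ici t) t :=
    intervalIntegral.integral_hasDerivWithinAt_right
      (drift_intervalIntegrable_of_continuous hf ε ω h.1 _ _) (t := Ioi t)
      (drift_measurable hf ε ω h.1.measurable).stronglyMeasurable.stronglyMeasurableAtFilter
      ((drift_continuousWithinAt hf ε ω h.1 t).mono Ioi_subset_Ici_self)
  refine (h1.const_sub m).congr_of_mem (fun s hs => ?_) self_mem_Ici
  have hs' : 0 ≤ s := ht.trans hs
  rw [h.2 s.toNNReal, Real.coe_toNNReal s hs']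
  rfl

/-- Strong convexity gives `d/dt ‖θ₁ - θ₂‖² ≤ -2κ ‖θ₁ - θ₂‖²` while the index paths agree. Allowing
two paths that agree only up to `t / ε` yields contraction, uniqueness and dependence on the past
alone from one statement. -/
theorem IsSGPC.norm_sub_le (hf : IsRegularTarget f) {κ : ℝ}
    (hconv : IsUniformlyStronglyConvex f κ) {ε : ℝ≥0} {m₁ m₂ : EuclideanSpace ℝ (Fin K)}
    {ω₁ ω₂ : CadlagPath S} {θ₁ θ₂ : ℝ≥0 → EuclideanSpace ℝ (Fin K)}
    (h₁ : IsSGPC f ε m₁ ω₁ θ₁) (h₂ : IsSGPC f ε m₂ ω₂ θ₂) {t : ℝ≥0}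
    (hω : ∀ s ≤ t / ε, ω₁ s = ω₂ s) :
    ‖θ₁ t - θ₂ t‖ ≤ Real.exp (-κ * t) * ‖m₁ - m₂‖ := by
  let φ : ℝ → EuclideanSpace ℝ (Fin K) := fun s => θ₁ s.toNNReal - θ₂ s.toNNReal
  have hφc : Continuous φ :=
    (h₁.1.comp continuous_real_toNNReal).sub (h₂.1.comp continuous_real_toNNReal)
  have key := image_le_of_deriv_right_le_deriv_boundary (a := 0) (b := t)
    (f := fun s => Real.exp (2 * κ * s) * ‖φ s‖ ^ 2)
    (f' := fun s => 2 * κ * Real.exp (2 * κ * s) * ‖φ s‖ ^ 2 + Real.exp (2 * κ * s) *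
      (2 * inner ℝ (φ s) (-drift f ε ω₁ θ₁ s - -drift f ε ω₂ θ₂ s)))
    (B := fun _ => ‖m₁ - m₂‖ ^ 2) (B' := fun _ => 0)
    (by fun_prop) ?_ ?_ continuousOn_const (fun s _ => hasDerivWithinAt_const _ _ _) ?_
    (right_mem_Icc.2 t.coe_nonneg)
  · have h0 : ‖φ t‖ ^ 2 ≤ (Real.exp (-κ * t) * ‖m₁ - m₂‖) ^ 2 := by
      have e1 : Real.exp (2 * κ * t) * Real.exp (-κ * t) ^ 2 = 1 := by
        rw [← Real.exp_nat_mul, ← Real.exp_add]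
        simp only [Nat.cast_ofNat]
        rw [show 2 * κ * (t : ℝ) + 2 * (-κ * t) = 0 by ring, Real.exp_zero]
      have e2 : 0 < Real.exp (-κ * t) ^ 2 := by positivity
      calc ‖φ t‖ ^ 2 = Real.exp (-κ * t) ^ 2 * (Real.exp (2 * κ * t) * ‖φ t‖ ^ 2) := by
            rw [← mul_assoc, mul_comm (Real.exp (-κ * t) ^ 2), e1, one_mul]
        _ ≤ Real.exp (-κ * t) ^ 2 * ‖m₁ - m₂‖ ^ 2 := by gcongr
        _ = _ := by ring
    have h1 := abs_le_of_sq_le_sq h0 (by positivity)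
    simpa [φ] using h1
  · intro s hs
    have hd := (h₁.hasDerivWithinAt hf hs.1).sub (h₂.hasDerivWithinAt hf hs.1)
    have he : HasDerivWithinAt (fun s : ℝ => Real.exp (2 * κ * s))
        (2 * κ * Real.exp (2 * κ * s)) (Ici s) s := by
      have h1 : HasDerivAt (fun s : ℝ => 2 * κ * s) (2 * κ) s := by
        simpa using (hasDerivAt_id s).const_mul (2 * κ)
      simpa [mul_comm] using h1.exp.hasDerivWithinAt
    exact he.mul hd.norm_sq
  · have e1 := h₁.2 0
    have e2 := h₂.2 0
    simp only [NNReal.coe_zero, intervalIntegral.integral_same, sub_zero] at e1 e2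
    simp [φ, e1, e2]
  · intro s hs
    have hω' : ω₁ (s.toNNReal / ε) = ω₂ (s.toNNReal / ε) := by
      apply hω
      gcongr
      exact Real.toNNReal_le_iff_le_coe.2 hs.2.le
    have h := hconv (ω₂ (s.toNNReal / ε)) (θ₁ s.toNNReal) (θ₂ s.toNNReal)
    have e : inner ℝ (φ s) (-drift f ε ω₁ θ₁ s - -drift f ε ω₂ θ₂ s) =
        - inner ℝ (θ₁ s.toNNReal - θ₂ s.toNNReal)
          (gradTheta f (θ₁ s.toNNReal) (ω₂ (s.toNNReal / ε)) -
            gradTheta f (θ₂ s.toNNReal) (ω₂ (s.toNNReal / ε))) := by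
      rw [← inner_neg_right, drift, drift, hω']
      congr 1
      abel
    rw [e]
    have hexp := Real.exp_pos (2 * κ * s)
    have : κ * ‖φ s‖ ^ 2 ≤ _ := h
    nlinarith

/-- Strong convexity between `θ` and `0` gives `-2⟪θ, ∇f(θ)⟫ ≤ -2κ‖θ‖² + 2κR‖θ‖ ≤ κ(R² - ‖θ‖²)`, so
`exp (κt) (‖θ‖² - R²)` is nonincreasing. -/
theorem IsSGPC.norm_le (hf : IsRegularTarget f) {κ : ℝ} (hκ : 0 < κ)
    (hconv : IsUniformlyStronglyConvex f κ) {R : ℝ} (hR0 : 0 ≤ R)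
    (hR : ∀ y, ‖gradTheta f 0 y‖ ≤ κ * R) {ε : ℝ≥0} {m : EuclideanSpace ℝ (Fin K)}
    {ω : CadlagPath S} {θ : ℝ≥0 → EuclideanSpace ℝ (Fin K)}
    (h : IsSGPC f ε m ω θ) (t : ℝ≥0) : ‖θ t‖ ≤ ‖m‖ + R := by
  let φ : ℝ → EuclideanSpace ℝ (Fin K) := fun s => θ s.toNNReal
  have hφc : Continuous φ := h.1.comp continuous_real_toNNReal
  have key := image_le_of_deriv_right_le_deriv_boundary (a := 0) (b := t)
    (f := fun s => Real.exp (κ * s) * (‖φ s‖ ^ 2 - R ^ 2))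
    (f' := fun s => κ * Real.exp (κ * s) * (‖φ s‖ ^ 2 - R ^ 2) + Real.exp (κ * s) *
      (2 * inner ℝ (φ s) (-drift f ε ω θ s)))
    (B := fun _ => ‖m‖ ^ 2 - R ^ 2) (B' := fun _ => 0)
    (by fun_prop) ?_ ?_ continuousOn_const (fun s _ => hasDerivWithinAt_const _ _ _) ?_
    (right_mem_Icc.2 t.coe_nonneg)
  · have e1 : 1 ≤ Real.exp (κ * t) := Real.one_le_exp (by positivity)
    have h0 : ‖φ t‖ ^ 2 ≤ ‖m‖ ^ 2 + R ^ 2 := by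
      by_contra hcon
      push Not at hcon
      nlinarith [sq_nonneg ‖m‖]
    have h1 : ‖φ t‖ ^ 2 ≤ (‖m‖ + R) ^ 2 := by nlinarith [norm_nonneg m]
    have h2 := abs_le_of_sq_le_sq h1 (by positivity)
    simpa [φ] using h2
  · intro s hs
    have he : HasDerivWithinAt (fun s : ℝ => Real.exp (κ * s))
        (κ * Real.exp (κ * s)) (Ici s) s := by
      have h1 : HasDerivAt (fun s : ℝ => κ * s) κ s := by
        simpa using (hasDerivAt_id s).const_mul κ
      simpa [mul_comm] using h1.exp.hasDerivWithinAt
    exact he.mul ((h.hasDerivWithinAt hf hs.1).norm_sq.sub_const _)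
  · have e1 := h.2 0
    simp only [NNReal.coe_zero, intervalIntegral.integral_same, sub_zero] at e1
    simp [φ, e1]
  · intro s hs
    have h1 := hconv (ω (s.toNNReal / ε)) (θ s.toNNReal) 0
    rw [sub_zero, inner_sub_right] at h1
    have h2 : -inner ℝ (θ s.toNNReal) (gradTheta f 0 (ω (s.toNNReal / ε))) ≤
        ‖φ s‖ * (κ * R) := by
      refine (neg_le_abs _).trans ((abs_real_inner_le_norm _ _).trans ?_)
      exact mul_le_mul_of_nonneg_left (hR _) (norm_nonneg _)
    have h3 : κ * ‖φ s‖ ^ 2 - ‖φ s‖ * (κ * R) ≤ inner ℝ (φ s) (drift f ε ω θ s) := by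
      simp only [φ, drift] at h2 ⊢
      linarith
    have hexp := Real.exp_pos (κ * s)
    rw [inner_neg_right]
    have h4 : κ * (‖φ s‖ ^ 2 - R ^ 2) - 2 * inner ℝ (φ s) (drift f ε ω θ s) ≤ 0 := by
      nlinarith [mul_nonneg hκ.le (sq_nonneg (‖φ s‖ - R))]
    calc _ = Real.exp (κ * s) *
          (κ * (‖φ s‖ ^ 2 - R ^ 2) - 2 * inner ℝ (φ s) (drift f ε ω θ s)) := by ring
      _ ≤ 0 := mul_nonpos_of_nonneg_of_nonpos hexp.le h4

/-! #### The solution map -/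

lemma sgpc_spec (hf : IsRegularTarget f) (ε : ℝ≥0) (m : EuclideanSpace ℝ (Fin K))
    (ω : CadlagPath S) : IsSGPC f ε m ω (sgpc f ε m ω) :=
  Classical.epsilon_spec ((exists_isSGPC_tendsto_picard hf ε m ω).imp fun _ h => h.1)

theorem IsSGPC.eq_sgpc (hf : IsRegularTarget f) {κ : ℝ} (hconv : IsUniformlyStronglyConvex f κ)
    {ε : ℝ≥0} {m : EuclideanSpace ℝ (Fin K)} {ω : CadlagPath S}
    {θ : ℝ≥0 → EuclideanSpace ℝ (Fin K)} (h : IsSGPC f ε m ω θ) : θ = sgpc f ε m ω := by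
  funext t
  have := h.norm_sub_le hf hconv (sgpc_spec hf ε m ω) (t := t) (fun _ _ => rfl)
  simpa [sub_eq_zero] using this

/-- By uniqueness the chosen solution is the limit of the Picard iterates, which are measurable. -/
lemma measurable_sgpc (hf : IsRegularTarget f) {κ : ℝ} (hconv : IsUniformlyStronglyConvex f κ)
    (ε t : ℝ≥0) : Measurable fun p : EuclideanSpace ℝ (Fin K) × CadlagPath S =>
      sgpc f ε p.1 p.2 t := by
  refine measurable_of_tendsto_metrizable
    (f := fun n (p : EuclideanSpace ℝ (Fin K) × CadlagPath S) => picard f ε p.1 p.2 n t)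
    (fun n => (measurable_picard hf ε n).comp (measurable_id.prodMk measurable_const)) ?_
  rw [tendsto_pi_nhds]
  intro p
  obtain ⟨θ, h, hlim⟩ := exists_isSGPC_tendsto_picard hf ε p.1 p.2
  rw [← h.eq_sgpc hf hconv]
  exact hlim t

lemma norm_sgpc_sub_le (hf : IsRegularTarget f) {κ : ℝ} (hconv : IsUniformlyStronglyConvex f κ)
    (ε : ℝ≥0) (m₁ m₂ : EuclideanSpace ℝ (Fin K)) (ω : CadlagPath S) (t : ℝ≥0) :
    ‖sgpc f ε m₁ ω t - sgpc f ε m₂ ω t‖ ≤ Real.exp (-κ * t) * ‖m₁ - m₂‖ :=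
  (sgpc_spec hf ε m₁ ω).norm_sub_le hf hconv (sgpc_spec hf ε m₂ ω) fun _ _ => rfl

lemma sgpc_stop (hf : IsRegularTarget f) {κ : ℝ} (hconv : IsUniformlyStronglyConvex f κ)
    (ε : ℝ≥0) (m : EuclideanSpace ℝ (Fin K)) (ω : CadlagPath S) (t : ℝ≥0) :
    sgpc f ε m (ω.stopAt (t / ε)) t = sgpc f ε m ω t := by
  have := (sgpc_spec hf ε m (ω.stopAt (t / ε))).norm_sub_le hf hconv (sgpc_spec hf ε m ω)
    (t := t) (fun s hs => by rw [CadlagPath.stopAt_apply, min_eq_left hs])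
  simpa [sub_eq_zero] using this

/-- The cocycle property: restarting at time `s` on the shifted path solves the same equation. With
`sgpc_stop` it reduces the Markov property of the pair to that of the index process. -/
lemma sgpc_add (hf : IsRegularTarget f) {κ : ℝ} (hconv : IsUniformlyStronglyConvex f κ)
    (ε : ℝ≥0) (m : EuclideanSpace ℝ (Fin K)) (ω : CadlagPath S) (s r : ℝ≥0) :
    sgpc f ε m ω (s + r) = sgpc f ε (sgpc f ε m ω s) (ω.shift (s / ε)) r := by
  have h := sgpc_spec hf ε m ω
  have hI := drift_intervalIntegrable_of_continuous hf ε ω h.1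
  have h' : IsSGPC f ε (sgpc f ε m ω s) (ω.shift (s / ε)) (fun r => sgpc f ε m ω (s + r)) := by
    refine ⟨h.1.comp (by fun_prop), fun t => ?_⟩
    have e1 : sgpc f ε m ω (s + t) = m - ∫ q in (0 : ℝ)..(s + t : ℝ≥0),
        drift f ε ω (sgpc f ε m ω) q := h.2 (s + t)
    have e2 : sgpc f ε m ω s = m - ∫ q in (0 : ℝ)..s, drift f ε ω (sgpc f ε m ω) q := h.2 s
    have e3 := intervalIntegral.integral_add_adjacent_intervals (hI 0 s) (hI s (s + t))
    have e4 : ∫ q in (s : ℝ)..(s + t), drift f ε ω (sgpc f ε m ω) q =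
        ∫ q in (0 : ℝ)..t, drift f ε ω (sgpc f ε m ω) (s + q) := by
      rw [intervalIntegral.integral_comp_add_left]
      simp
    have e5 : ∫ q in (0 : ℝ)..t, drift f ε ω (sgpc f ε m ω) (s + q) =
        ∫ q in (0 : ℝ)..t, gradTheta f (sgpc f ε m ω (s + q.toNNReal))
          ((ω.shift (s / ε)) (q.toNNReal / ε)) := by
      refine intervalIntegral.integral_congr fun q hq => ?_
      rw [uIcc_of_le t.coe_nonneg] at hq
      have : ((s : ℝ) + q).toNNReal = s + q.toNNReal := by
        rw [Real.toNNReal_add s.coe_nonneg hq.1, Real.toNNReal_coe]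
      simp only [drift, this, CadlagPath.shift_apply, add_div]
    beta_reduce
    rw [← e5, ← e4, e1, e2, NNReal.coe_add, ← e3]
    abel
  exact congrFun (h'.eq_sgpc hf hconv) r

end Flow

/-! ### The Markov property on path space -/

section Markov

variable {S : Type u} [TopologicalSpace S] [MeasurableSpace S]

instance FellerProcess.instIsMarkovKernel (V : FellerProcess S) : IsMarkovKernel V.P := ⟨V.prob⟩

lemma FellerProcess.lintegral_transition (V : FellerProcess S) (t : ℝ≥0) (x : S)
    {h : S → ℝ≥0∞} (hh : Measurable h) :
    ∫⁻ y, h y ∂V.transition t x = ∫⁻ ω, h (ω t) ∂V.P x :=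
  lintegral_map hh (CadlagPath.measurable_eval t)

lemma FellerProcess.measurable_transition (V : FellerProcess S) (t : ℝ≥0) :
    Measurable (V.transition t) := by
  have h : V.transition t = V.P.map (fun ω => ω t) := by
    funext x
    rw [Kernel.map_apply _ (CadlagPath.measurable_eval t)]
    rfl
  rw [h]
  exact Kernel.measurable _

lemma FellerProcess.ae_start [MeasurableSingletonClass S] (V : FellerProcess S) (x : S) :
    ∀ᵐ ω ∂V.P x, ω 0 = x := by
  have hm : MeasurableSet {ω : CadlagPath S | ω 0 = x} :=
    CadlagPath.measurable_eval 0 (measurableSet_singleton x)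
  exact (mem_ae_iff_prob_eq_one hm).2 (V.start x)

variable {V : FellerProcess S} {Ω : Type w} {mΩ : MeasurableSpace Ω} {μ : Measure Ω}
  {ℱ : Filtration ℝ≥0 mΩ} {X : Ω → CadlagPath S}

lemma prod_indicator_one {ι α : Type*} (t : Finset ι) (A : ι → Set α) (x : ι → α)
    [Decidable (∀ i ∈ t, x i ∈ A i)] :
    (∏ i ∈ t, (A i).indicator (1 : α → ℝ≥0∞) (x i)) = if ∀ i ∈ t, x i ∈ A i then 1 else 0 := by
  split_ifs with h
  · refine Finset.prod_eq_one fun i hi => ?_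
    rw [indicator_of_mem (h i hi)]
    rfl
  · push Not at h
    obtain ⟨i, hi, hi'⟩ := h
    exact Finset.prod_eq_zero hi (indicator_of_notMem hi' _)

namespace IsMarkovProcess

lemma measurable_eval {Q : ℝ≥0 → S → Measure S} (hX : IsMarkovProcess Q μ ℱ X) {s t : ℝ≥0}
    (hst : s ≤ t) : Measurable[ℱ t] fun ω => X ω s :=
  (hX.1 s).mono (ℱ.mono hst) le_rfl

lemma measurable_eval' {Q : ℝ≥0 → S → Measure S} (hX : IsMarkovProcess Q μ ℱ X) (t : ℝ≥0) :
    Measurable fun ω => X ω t :=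
  (hX.1 t).mono (ℱ.le t) le_rfl

lemma measurable {Q : ℝ≥0 → S → Measure S} (hX : IsMarkovProcess Q μ ℱ X) : Measurable X :=
  CadlagPath.measurable_of_eval hX.measurable_eval'

lemma measurable_stop {Q : ℝ≥0 → S → Measure S} (hX : IsMarkovProcess Q μ ℱ X) (s : ℝ≥0) :
    Measurable[ℱ s] fun ω => (X ω).stopAt s :=
  CadlagPath.measurable_of_eval fun _ => hX.measurable_eval (min_le_right _ _)

lemma setLIntegral_eq (hX : IsMarkovProcess V.transition μ ℱ X) (s t : ℝ≥0) {B : Set Ω}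
    (hB : MeasurableSet[ℱ s] B) {h : S → ℝ≥0∞} (hh : Measurable h) :
    ∫⁻ ω in B, h (X ω (s + t)) ∂μ = ∫⁻ ω in B, ∫⁻ ω', h (ω' t) ∂V.P (X ω s) ∂μ := by
  have hm : Measurable fun ω => V.transition t (X ω s) :=
    (V.measurable_transition t).comp (hX.measurable_eval' s)
  have e : (μ.restrict B).map (fun ω => X ω (s + t)) =
      (μ.restrict B).bind (fun ω => V.transition t (X ω s)) := by
    ext A hA
    rw [Measure.map_apply (hX.measurable_eval' _) hA,
      Measure.restrict_apply (hX.measurable_eval' _ hA), Measure.bind_apply hA hm.aemeasurable,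
      inter_comm]
    exact hX.2 s t A hA B hB
  rw [← lintegral_map hh (hX.measurable_eval' _), e,
    Measure.lintegral_bind hm.aemeasurable hh.aemeasurable]
  simp_rw [V.lintegral_transition t _ hh]

/-- Equality on all events of `ℱ s` says that two densities define the same measure after trimming
to `ℱ s`, and this extends it to `ℱ s`-measurable weights. -/
lemma lintegral_mul_eq (hX : IsMarkovProcess V.transition μ ℱ X) (s t : ℝ≥0) {φ : Ω → ℝ≥0∞}
    (hφ : Measurable[ℱ s] φ) {h : S → ℝ≥0∞} (hh : Measurable h) :
    ∫⁻ ω, φ ω * h (X ω (s + t)) ∂μ = ∫⁻ ω, φ ω * ∫⁻ ω', h (ω' t) ∂V.P (X ω s) ∂μ := by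
  have hφ' : Measurable φ := hφ.mono (ℱ.le s) le_rfl
  have h1 : Measurable fun ω => h (X ω (s + t)) := hh.comp (hX.measurable_eval' _)
  have h2 : Measurable fun ω => ∫⁻ ω', h (ω' t) ∂V.P (X ω s) :=
    (Measurable.lintegral_kernel (hh.comp (CadlagPath.measurable_eval t))).comp
      (hX.measurable_eval' s)
  have e : (μ.withDensity fun ω => h (X ω (s + t))).trim (ℱ.le s) =
      (μ.withDensity fun ω => ∫⁻ ω', h (ω' t) ∂V.P (X ω s)).trim (ℱ.le s) := by
    refine @Measure.ext _ (ℱ s) _ _ fun B hB => ?_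
    rw [trim_measurableSet_eq _ hB, trim_measurableSet_eq _ hB,
      withDensity_apply _ (ℱ.le s _ hB), withDensity_apply _ (ℱ.le s _ hB)]
    exact hX.setLIntegral_eq s t hB hh
  have e1 := lintegral_withDensity_eq_lintegral_mul μ h1 hφ'
  have e2 := lintegral_withDensity_eq_lintegral_mul μ h2 hφ'
  rw [← lintegral_trim (ℱ.le s) hφ] at e1 e2
  rw [e, e2] at e1
  simp only [Pi.mul_apply] at e1
  simp_rw [mul_comm (φ _)]
  exact e1.symm

/-- Induction on the largest time. Conditioning at `b` replaces the factor at the later time `c` by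
a function of the state at `b`, both for `X` under `μ` and for the canonical process under each `V.P
y`, leaving a product with one factor fewer. -/
lemma lintegral_mul_prod_eq (hX : IsMarkovProcess V.transition μ ℱ X) (s : ℝ≥0)
    {φ : Ω → ℝ≥0∞} (hφ : Measurable[ℱ s] φ) {g : ℝ≥0 → S → ℝ≥0∞} (hg : ∀ i, Measurable (g i))
    (t : Finset ℝ≥0) : ∀ c, (∀ i ∈ t, i ≤ c) → ∀ h : S → ℝ≥0∞, Measurable h →
    ∫⁻ ω, φ ω * ((∏ i ∈ t, g i (X ω (s + i))) * h (X ω (s + c))) ∂μ =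
      ∫⁻ ω, φ ω * ∫⁻ ω', (∏ i ∈ t, g i (ω' i)) * h (ω' c) ∂V.P (X ω s) ∂μ := by
  induction t using Finset.induction_on_max with
  | empty =>
    intro c _ h hh
    simpa using hX.lintegral_mul_eq s c hφ hh
  | insert b t hb ih =>
    intro c hc h hh
    have hbc : b ≤ c := hc b (Finset.mem_insert_self b t)
    have hbt : b ∉ t := fun hbt => lt_irrefl _ (hb b hbt)
    have hQ : Measurable fun y => ∫⁻ ω', h (ω' (c - b)) ∂V.P y :=
      Measurable.lintegral_kernel (hh.comp (CadlagPath.measurable_eval _))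
    have hk : Measurable fun y => g b y * ∫⁻ ω', h (ω' (c - b)) ∂V.P y := (hg b).mul hQ
    have e1 : ∀ y, ∫⁻ ω', (∏ i ∈ insert b t, g i (ω' i)) * h (ω' c) ∂V.P y =
        ∫⁻ ω', (∏ i ∈ t, g i (ω' i)) *
          (g b (ω' b) * ∫⁻ ω'', h (ω'' (c - b)) ∂V.P (ω' b)) ∂V.P y := by
      intro y
      have hw : Measurable[V.ℱ b] fun ω' : CadlagPath S => ∏ i ∈ insert b t, g i (ω' i) :=
        Finset.measurable_fun_prod _ fun i hi =>
          (hg i).comp ((V.markov y).measurable_eval (X := id) (by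
            rcases Finset.mem_insert.1 hi with rfl | hi
            · exact le_rfl
            · exact (hb i hi).le))
      have := IsMarkovProcess.lintegral_mul_eq (V := V) (X := id) (V.markov y) b (c - b) hw hh
      rw [add_tsub_cancel_of_le hbc] at this
      simp only [id] at this
      rw [this]
      refine lintegral_congr fun ω' => ?_
      rw [Finset.prod_insert hbt]
      ring
    simp_rw [e1]
    rw [← ih b (fun i hi => (hb i hi).le) _ hk]
    have hw : Measurable[ℱ (s + b)] fun ω => φ ω * ∏ i ∈ insert b t, g i (X ω (s + i)) := by
      refine (hφ.mono (ℱ.mono le_self_add) le_rfl).mul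
        (Finset.measurable_fun_prod _ fun i hi => (hg i).comp (hX.measurable_eval ?_))
      rcases Finset.mem_insert.1 hi with rfl | hi
      · exact le_rfl
      · exact add_le_add_right (hb i hi).le s
    have := hX.lintegral_mul_eq (s + b) (c - b) hw hh
    rw [add_assoc, add_tsub_cancel_of_le hbc] at this
    simp_rw [← mul_assoc]
    rw [this]
    refine lintegral_congr fun ω => ?_
    rw [Finset.prod_insert hbt]
    ring

/-- The Markov property for the entire future path: both sides are finite measures in `D`, so
agreement on finite-dimensional cylinders suffices. -/
theorem measure_inter_shift [IsFiniteMeasure μ] (hX : IsMarkovProcess V.transition μ ℱ X)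
    (s : ℝ≥0) {B : Set Ω} (hB : MeasurableSet[ℱ s] B) {D : Set (CadlagPath S)}
    (hD : MeasurableSet D) :
    μ (B ∩ {ω | (X ω).shift s ∈ D}) = ∫⁻ ω in B, V.P (X ω s) D ∂μ := by
  have hm : Measurable fun ω => V.P (X ω s) := V.P.measurable.comp (hX.measurable_eval' s)
  have hsh : Measurable fun ω => (X ω).shift s :=
    (CadlagPath.measurable_shift s).comp hX.measurable
  suffices e : (μ.restrict B).map (fun ω => (X ω).shift s) =
      (μ.restrict B).bind (fun ω => V.P (X ω s)) by
    have := congrArg (fun ν : Measure (CadlagPath S) => ν D) e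
    beta_reduce at this
    rw [Measure.map_apply hsh hD, Measure.restrict_apply (hsh hD),
      Measure.bind_apply hD hm.aemeasurable] at this
    rw [← this, inter_comm]
    rfl
  have hcyl : ∀ (t : Finset ℝ≥0) (A : ℝ≥0 → Set S), (∀ i, MeasurableSet (A i)) →
      μ.restrict B {ω | ∀ i ∈ t, X ω (s + i) ∈ A i} =
        ∫⁻ ω in B, V.P (X ω s) {ω' | ∀ i ∈ t, ω' i ∈ A i} ∂μ := by
    classical
    intro t A hA
    have h1 : Measurable[ℱ s] (B.indicator (1 : Ω → ℝ≥0∞)) :=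
      (@measurable_const ℝ≥0∞ Ω _ (ℱ s) 1).indicator hB
    -- The separate last factor is taken to be `1`, at a time `t.sup id` that dominates all of `t`.
    have h2 := hX.lintegral_mul_prod_eq s h1 (g := fun i => (A i).indicator 1)
      (fun i => measurable_one.indicator (hA i)) t (t.sup id)
      (fun i hi => Finset.le_sup (f := id) hi) 1 measurable_one
    have hm1 : MeasurableSet {ω | ∀ i ∈ t, X ω (s + i) ∈ A i} := by
      have : {ω | ∀ i ∈ t, X ω (s + i) ∈ A i} = ⋂ i ∈ t, {ω | X ω (s + i) ∈ A i} := by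
        ext; simp
      rw [this]
      exact Finset.measurableSet_biInter _ fun i _ => hX.measurable_eval' _ (hA i)
    have hm2 : MeasurableSet {ω' : CadlagPath S | ∀ i ∈ t, ω' i ∈ A i} := by
      have : {ω' : CadlagPath S | ∀ i ∈ t, ω' i ∈ A i} =
          ⋂ i ∈ t, {ω' : CadlagPath S | ω' i ∈ A i} := by
        ext; simp
      rw [this]
      exact Finset.measurableSet_biInter _ fun i _ => CadlagPath.measurable_eval _ (hA i)
    rw [← lintegral_indicator_one hm1, ← lintegral_indicator (ℱ.le s _ hB),
      ← lintegral_indicator (ℱ.le s _ hB)]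
    refine Eq.trans (lintegral_congr fun ω => ?_) (h2.trans (lintegral_congr fun ω => ?_))
    · rw [prod_indicator_one t A (fun i => X ω (s + i))]
      by_cases hω : ω ∈ B <;> simp [hω, indicator]
    · have : ∀ ω' : CadlagPath S, (∏ i ∈ t, (A i).indicator (1 : S → ℝ≥0∞) (ω' i)) *
          (1 : S → ℝ≥0∞) (ω' (t.sup id)) =
          {ω' : CadlagPath S | ∀ i ∈ t, ω' i ∈ A i}.indicator 1 ω' := by
        intro ω'
        rw [prod_indicator_one t A (fun i => ω' i)]
        simp [indicator]
      rw [lintegral_congr this, lintegral_indicator_one hm2]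
      by_cases hω : ω ∈ B <;> simp [hω]
  refine ext_of_generate_finite _
    (generateFrom_piiUnionInter_measurableSet (fun t : ℝ≥0 =>
      MeasurableSpace.comap (fun ω : CadlagPath S => ω t) inferInstance) univ
      |>.trans (by simp; rfl)).symm
    (isPiSystem_piiUnionInter _ (fun t => @MeasurableSpace.isPiSystem_measurableSet _ (MeasurableSpace.comap
      (fun ω : CadlagPath S => ω t) inferInstance)) _) ?_ ?_
  · rintro E ⟨t, -, F, hF, rfl⟩
    have hF' : ∀ i, ∃ A : Set S, MeasurableSet A ∧
        (i ∈ t → (fun ω : CadlagPath S => ω i) ⁻¹' A = F i) := by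
      intro i
      by_cases hi : i ∈ t
      · obtain ⟨A, hA, hAF⟩ := hF i hi
        exact ⟨A, hA, fun _ => hAF⟩
      · exact ⟨∅, MeasurableSet.empty, fun h => absurd h hi⟩
    choose A hA hAF using hF'
    have hE : (⋂ i ∈ t, F i) = {ω' : CadlagPath S | ∀ i ∈ t, ω' i ∈ A i} := by
      ext ω'
      simp only [mem_iInter, mem_ofPred_eq]
      refine forall₂_congr fun i hi => ?_
      rw [← hAF i hi]
      rfl
    have hEm : MeasurableSet (⋂ i ∈ t, F i) :=
      Finset.measurableSet_biInter _ fun i hi => by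
        rw [← hAF i hi]; exact CadlagPath.measurable_eval i (hA i)
    rw [Measure.map_apply hsh hEm, Measure.bind_apply hEm hm.aemeasurable, hE]
    exact hcyl t A hA
  · rw [Measure.map_apply hsh MeasurableSet.univ,
      Measure.bind_apply MeasurableSet.univ hm.aemeasurable]
    simp

/-- Given the path stopped at `s`, the shifted path is distributed as the process started at the
current state; the conditional law is packaged as a kernel so that functionals of past and future
can be integrated together. -/
theorem map_stop_shift [IsFiniteMeasure μ] (hX : IsMarkovProcess V.transition μ ℱ X) (s : ℝ≥0) :
    μ.map (fun ω => ((X ω).stopAt s, (X ω).shift s)) =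
      (μ.map fun ω => (X ω).stopAt s) ⊗ₘ
        V.P.comap (fun ω => ω s) (CadlagPath.measurable_eval s) := by
  have h1 : Measurable fun ω => (X ω).stopAt s := (hX.measurable_stop s).mono (ℱ.le s) le_rfl
  have h2 : Measurable fun ω => (X ω).shift s :=
    (CadlagPath.measurable_shift s).comp hX.measurable
  refine Measure.ext_prod fun {B D} hB hD => ?_
  rw [Measure.map_apply (h1.prodMk h2) (hB.prod hD), Measure.compProd_apply_prod hB hD,
    setLIntegral_map hB (Kernel.measurable_coe _ hD) h1]
  have := hX.measure_inter_shift s (hX.measurable_stop s hB) hD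
  rw [mk_preimage_prod]
  refine Eq.trans this ?_
  simp

lemma lintegral_stop_shift [IsFiniteMeasure μ] (hX : IsMarkovProcess V.transition μ ℱ X)
    (s : ℝ≥0) {Ψ : CadlagPath S × CadlagPath S → ℝ≥0∞} (hΨ : Measurable Ψ) :
    ∫⁻ ω, Ψ ((X ω).stopAt s, (X ω).shift s) ∂μ =
      ∫⁻ ω, ∫⁻ ω', Ψ ((X ω).stopAt s, ω') ∂V.P (X ω s) ∂μ := by
  have h1 : Measurable fun ω => (X ω).stopAt s := (hX.measurable_stop s).mono (ℱ.le s) le_rfl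
  have h2 : Measurable fun ω => (X ω).shift s :=
    (CadlagPath.measurable_shift s).comp hX.measurable
  rw [← lintegral_map hΨ (h1.prodMk h2), hX.map_stop_shift s, Measure.lintegral_compProd hΨ,
    lintegral_map _ h1]
  · simp
  · exact Measurable.lintegral_kernel_prod_right' hΨ

end IsMarkovProcess

end Markov

/-! ### The transition kernels of the coupled process -/

section Coupled

variable {K : ℕ} {S : Type u} [TopologicalSpace S] [PolishSpace S] [CompactSpace S]
  [MeasurableSpace S] [BorelSpace S] {f : EuclideanSpace ℝ (Fin K) → S → ℝ} {κ : ℝ}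
  {V : FellerProcess S} {π : Measure S}

lemma measurable_coupled (hf : IsRegularTarget f) (hconv : IsUniformlyStronglyConvex f κ)
    (ε t : ℝ≥0) : Measurable fun p : EuclideanSpace ℝ (Fin K) × CadlagPath S =>
      (sgpc f ε p.1 p.2 t, p.2 (t / ε)) :=
  (measurable_sgpc hf hconv ε t).prodMk
    ((CadlagPath.measurable_eval (t / ε)).comp measurable_snd)

lemma measurable_coupled_right (hf : IsRegularTarget f) (hconv : IsUniformlyStronglyConvex f κ)
    (ε t : ℝ≥0) (m : EuclideanSpace ℝ (Fin K)) : Measurable fun ω : CadlagPath S =>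
      (sgpc f ε m ω t, ω (t / ε)) :=
  (measurable_coupled hf hconv ε t).comp measurable_prodMk_left

/-- The transition kernel `z ↦ H^ε_t(· | z)` of the coupled process. -/
noncomputable def coupledKernel (V : FellerProcess S) (f : EuclideanSpace ℝ (Fin K) → S → ℝ)
    (ε t : ℝ≥0) : Kernel (EuclideanSpace ℝ (Fin K) × S) (EuclideanSpace ℝ (Fin K) × S) :=
  (Kernel.id ×ₖ V.P.comap Prod.snd measurable_snd).map
    fun p => (sgpc f ε p.1.1 p.2 t, p.2 (t / ε))

lemma coupledKernel_apply (hf : IsRegularTarget f) (hconv : IsUniformlyStronglyConvex f κ)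
    (V : FellerProcess S) (ε t : ℝ≥0) (z : EuclideanSpace ℝ (Fin K) × S) :
    coupledKernel V f ε t z = coupledLaw f ε t z.1 (V.P z.2) := by
  have hm : Measurable fun p : (EuclideanSpace ℝ (Fin K) × S) × CadlagPath S =>
      (sgpc f ε p.1.1 p.2 t, p.2 (t / ε)) :=
    (measurable_coupled hf hconv ε t).comp
      ((measurable_fst.comp measurable_fst).prodMk measurable_snd)
  rw [coupledKernel, Kernel.map_apply _ hm, Kernel.prod_apply, Kernel.id_apply,
    Kernel.comap_apply, Measure.dirac_prod, Measure.map_map hm measurable_prodMk_left]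
  rfl

lemma isMarkovKernel_coupledKernel (hf : IsRegularTarget f)
    (hconv : IsUniformlyStronglyConvex f κ) (V : FellerProcess S) (ε t : ℝ≥0) :
    IsMarkovKernel (coupledKernel V f ε t) :=
  ⟨fun z => by
    rw [coupledKernel_apply hf hconv]
    exact Measure.isProbabilityMeasure_map
      (measurable_coupled_right hf hconv ε t z.1).aemeasurable⟩

lemma lintegral_coupledKernel (hf : IsRegularTarget f) (hconv : IsUniformlyStronglyConvex f κ)
    (V : FellerProcess S) (ε t : ℝ≥0) (z : EuclideanSpace ℝ (Fin K) × S)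
    {φ : EuclideanSpace ℝ (Fin K) × S → ℝ≥0∞} (hφ : Measurable φ) :
    ∫⁻ z', φ z' ∂coupledKernel V f ε t z =
      ∫⁻ ω, φ (sgpc f ε z.1 ω t, ω (t / ε)) ∂V.P z.2 := by
  rw [coupledKernel_apply hf hconv, coupledLaw,
    lintegral_map hφ (measurable_coupled_right hf hconv ε t z.1)]

lemma integral_coupledKernel (hf : IsRegularTarget f) (hconv : IsUniformlyStronglyConvex f κ)
    (V : FellerProcess S) (ε t : ℝ≥0) (z : EuclideanSpace ℝ (Fin K) × S)
    {φ : EuclideanSpace ℝ (Fin K) × S → ℝ} (hφ : Measurable φ) :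
    ∫ z', φ z' ∂coupledKernel V f ε t z =
      ∫ ω, φ (sgpc f ε z.1 ω t, ω (t / ε)) ∂V.P z.2 := by
  rw [coupledKernel_apply hf hconv, coupledLaw,
    integral_map (measurable_coupled_right hf hconv ε t z.1).aemeasurable
      hφ.aestronglyMeasurable]

/-- The first component at time `s` depends only on the index path stopped at `s / ε`, and what
follows is driven by the shifted path; the Markov property at index time `s / ε` therefore gives
Chapman–Kolmogorov. -/
theorem coupledKernel_add (hf : IsRegularTarget f) (hconv : IsUniformlyStronglyConvex f κ)
    (V : FellerProcess S) (ε s r : ℝ≥0) :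
    coupledKernel V f ε (s + r) = coupledKernel V f ε r ∘ₖ coupledKernel V f ε s := by
  refine Kernel.ext_fun fun z φ hφ => ?_
  have hmeas : Measurable fun z' => ∫⁻ z'', φ z'' ∂coupledKernel V f ε r z' :=
    hφ.lintegral_kernel
  rw [Kernel.lintegral_comp _ _ _ hφ, lintegral_coupledKernel hf hconv V ε _ z hφ,
    lintegral_coupledKernel hf hconv V ε s z hmeas]
  simp_rw [lintegral_coupledKernel hf hconv V ε r _ hφ]
  have hΨ : Measurable fun p : CadlagPath S × CadlagPath S =>
      φ (sgpc f ε (sgpc f ε z.1 p.1 s) p.2 r, p.2 (r / ε)) :=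
    hφ.comp ((measurable_coupled hf hconv ε r).comp
      (((measurable_sgpc hf hconv ε s).comp
        (measurable_const.prodMk measurable_fst)).prodMk measurable_snd))
  have := IsMarkovProcess.lintegral_stop_shift (V := V) (X := id) (V.markov z.2) (s / ε) hΨ
  simp only [id, sgpc_stop hf hconv] at this
  rw [← this]
  refine lintegral_congr fun ω => ?_
  rw [sgpc_add hf hconv, CadlagPath.shift_apply, add_div]

lemma coupledLaw_lawFrom (hf : IsRegularTarget f) (hconv : IsUniformlyStronglyConvex f κ)
    (V : FellerProcess S) (π : Measure S) [SFinite π] (ε t : ℝ≥0)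
    (m : EuclideanSpace ℝ (Fin K)) :
    coupledLaw f ε t m (V.lawFrom π) =
      ((Measure.dirac m).prod π).bind (coupledKernel V f ε t) := by
  refine Measure.ext_of_lintegral _ fun φ hφ => ?_
  have hm := measurable_coupled_right hf hconv ε t m
  have hc : Measurable fun ω : CadlagPath S => φ (sgpc f ε m ω t, ω (t / ε)) := hφ.comp hm
  rw [coupledLaw, lintegral_map hφ hm, FellerProcess.lawFrom,
    Measure.lintegral_bind V.P.aemeasurable hc.aemeasurable,
    Measure.lintegral_bind (Kernel.aemeasurable _) hφ.aemeasurable, Measure.dirac_prod,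
    lintegral_map hφ.lintegral_kernel measurable_prodMk_left]
  simp_rw [lintegral_coupledKernel hf hconv V ε t _ hφ]

lemma isStationaryMeasure_iff (hf : IsRegularTarget f) (hconv : IsUniformlyStronglyConvex f κ)
    {ε : ℝ≥0} {ρ : Measure (EuclideanSpace ℝ (Fin K) × S)} :
    IsStationaryMeasure V f ε ρ ↔
      IsProbabilityMeasure ρ ∧ ∀ t, ρ.bind (coupledKernel V f ε t) = ρ := by
  refine and_congr_right fun _ => forall_congr' fun t => ?_
  rw [Measure.ext_iff]
  refine forall₂_congr fun B hB => ?_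
  rw [Measure.bind_apply hB (Kernel.aemeasurable _)]
  simp_rw [coupledKernel_apply hf hconv]

lemma snd_bind_coupledKernel (hf : IsRegularTarget f) (hconv : IsUniformlyStronglyConvex f κ)
    (V : FellerProcess S) (ρ : Measure (EuclideanSpace ℝ (Fin K) × S)) (ε t : ℝ≥0) :
    (ρ.bind (coupledKernel V f ε t)).snd = ρ.snd.bind (V.transition (t / ε)) := by
  refine Measure.ext_of_lintegral _ fun φ hφ => ?_
  have hc : Measurable fun z : EuclideanSpace ℝ (Fin K) × S => φ z.2 := hφ.comp measurable_snd
  rw [Measure.snd, Measure.snd, lintegral_map hφ measurable_snd,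
    Measure.lintegral_bind (Kernel.aemeasurable _) hc.aemeasurable,
    Measure.lintegral_bind (V.measurable_transition _).aemeasurable hφ.aemeasurable,
    lintegral_map]
  · refine lintegral_congr fun z => ?_
    rw [lintegral_coupledKernel hf hconv V ε t z hc,
      V.lintegral_transition _ _ hφ]
  · simp_rw [V.lintegral_transition _ _ hφ]
    exact (hφ.comp (CadlagPath.measurable_eval _)).lintegral_kernel
  · exact measurable_snd

lemma FellerProcess.IsInvariant.bind_eq (hπ : V.IsInvariant π) (t : ℝ≥0) :
    π.bind (V.transition t) = π := by
  ext A hA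
  rw [Measure.bind_apply hA (V.measurable_transition t).aemeasurable]
  exact hπ.2 t A hA

/-- The index component evolves on its own, and coupled time `t * ε` is index time `t`, so the
second marginal is invariant for the index process. -/
lemma snd_eq_of_isStationaryMeasure (hf : IsRegularTarget f)
    (hconv : IsUniformlyStronglyConvex f κ) (hπ : V.IsUniqueInvariant π) {ε : ℝ≥0} (hε : 0 < ε)
    {ρ : Measure (EuclideanSpace ℝ (Fin K) × S)} (hρ : IsStationaryMeasure V f ε ρ) :
    ρ.snd = π := by
  obtain ⟨hp, hs⟩ := (isStationaryMeasure_iff hf hconv).1 hρ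
  refine hπ.2 _ ⟨inferInstance, fun t A hA => ?_⟩
  have h := snd_bind_coupledKernel hf hconv V ρ ε (t * ε)
  rw [hs, mul_div_cancel_right₀ _ hε.ne'] at h
  rw [← Measure.bind_apply hA (V.measurable_transition t).aemeasurable, ← h]

/-! ### Test functions that are Lipschitz in the first variable -/

lemma integrable_of_abs_le {α : Type*} [MeasurableSpace α] {μ : Measure α} [IsFiniteMeasure μ]
    {φ : α → ℝ} (hφ : Measurable φ) {M : ℝ} (hM : ∀ z, |φ z| ≤ M) : Integrable φ μ :=
  Integrable.of_bound hφ.aestronglyMeasurable M (Eventually.of_forall hM)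

lemma integral_bind_kernel {α β : Type*} [MeasurableSpace α] [MeasurableSpace β] {μ : Measure α}
    [IsFiniteMeasure μ] (η : Kernel α β) [IsMarkovKernel η] {φ : β → ℝ} (hφ : Measurable φ)
    {M : ℝ} (hM : ∀ z, |φ z| ≤ M) :
    ∫ z, φ z ∂μ.bind η = ∫ x, ∫ z, φ z ∂η x ∂μ := by
  rw [← Measure.snd_compProd, Measure.snd, integral_map measurable_snd.aemeasurable
    hφ.aestronglyMeasurable, Measure.integral_compProd]
  exact integrable_of_abs_le (hφ.comp measurable_snd) fun z => hM _

lemma abs_integral_le_of_abs_le {α : Type*} [MeasurableSpace α] {μ : Measure α}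
    [IsProbabilityMeasure μ] {φ : α → ℝ} {M : ℝ} (hM : ∀ z, |φ z| ≤ M) :
    |∫ z, φ z ∂μ| ≤ M := by
  have := norm_integral_le_of_norm_le_const (μ := μ) (f := φ) (C := M) (Eventually.of_forall hM)
  simpa using this

/-- Running both starting points along the same index path shows that the kernels preserve the class
of bounded functions Lipschitz in the first variable and shrink the Lipschitz constant. -/
lemma abs_integral_coupledKernel_sub_le (hf : IsRegularTarget f)
    (hconv : IsUniformlyStronglyConvex f κ) (V : FellerProcess S) (ε t : ℝ≥0)
    {φ : EuclideanSpace ℝ (Fin K) × S → ℝ} (hφ : Measurable φ) {M L : ℝ}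
    (hM : ∀ z, |φ z| ≤ M) (hL0 : 0 ≤ L) (hL : ∀ x x' y, |φ (x, y) - φ (x', y)| ≤ L * ‖x - x'‖)
    (x x' : EuclideanSpace ℝ (Fin K)) (y : S) :
    |∫ z, φ z ∂coupledKernel V f ε t (x, y) - ∫ z, φ z ∂coupledKernel V f ε t (x', y)| ≤
      L * Real.exp (-κ * t) * ‖x - x'‖ := by
  have hi : ∀ m, Integrable (fun ω => φ (sgpc f ε m ω t, ω (t / ε))) (V.P y) := fun m =>
    integrable_of_abs_le (hφ.comp (measurable_coupled_right hf hconv ε t m)) fun _ => hM _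
  rw [integral_coupledKernel hf hconv V ε t _ hφ, integral_coupledKernel hf hconv V ε t _ hφ,
    ← integral_sub (hi x) (hi x')]
  refine abs_integral_le_of_abs_le fun ω => (hL _ _ _).trans ?_
  rw [mul_assoc]
  exact mul_le_mul_of_nonneg_left (norm_sgpc_sub_le hf hconv ε x x' ω t) hL0

lemma measurable_integral_coupledKernel (hf : IsRegularTarget f)
    (hconv : IsUniformlyStronglyConvex f κ) (V : FellerProcess S) (ε t : ℝ≥0)
    {φ : EuclideanSpace ℝ (Fin K) × S → ℝ} (hφ : Measurable φ) :
    Measurable fun z => ∫ z', φ z' ∂coupledKernel V f ε t z := by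
  have := isMarkovKernel_coupledKernel hf hconv V ε t
  exact (hφ.stronglyMeasurable.integral_kernel (κ := coupledKernel V f ε t)).measurable

/-- Started with the correct second marginal, the coupled process forgets the initial value of
its first component. -/
lemma abs_integral_bind_sub_le (hf : IsRegularTarget f)
    (hconv : IsUniformlyStronglyConvex f κ) (V : FellerProcess S) (ε t : ℝ≥0)
    {φ : EuclideanSpace ℝ (Fin K) × S → ℝ} (hφ : Measurable φ) {M L : ℝ}
    (hM : ∀ z, |φ z| ≤ M) (hL0 : 0 ≤ L) (hL : ∀ x x' y, |φ (x, y) - φ (x', y)| ≤ L * ‖x - x'‖)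
    (ρ : Measure (EuclideanSpace ℝ (Fin K) × S)) [IsProbabilityMeasure ρ]
    (m : EuclideanSpace ℝ (Fin K)) :
    |∫ z, φ z ∂ρ.bind (coupledKernel V f ε t) -
        ∫ z, φ z ∂((Measure.dirac m).prod ρ.snd).bind (coupledKernel V f ε t)| ≤
      ∫ z, min (2 * M) (L * Real.exp (-κ * t) * ‖z.1 - m‖) ∂ρ := by
  have := isMarkovKernel_coupledKernel hf hconv V ε t
  have hm := measurable_integral_coupledKernel hf hconv V ε t hφ
  have hMk : ∀ z, |∫ z', φ z' ∂coupledKernel V f ε t z| ≤ M := fun z =>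
    abs_integral_le_of_abs_le hM
  have hp : Measurable fun z : EuclideanSpace ℝ (Fin K) × S => (m, z.2) :=
    measurable_const.prodMk measurable_snd
  have hc : Measurable fun y => ∫ z', φ z' ∂coupledKernel V f ε t (m, y) :=
    hm.comp measurable_prodMk_left
  have hi : Integrable (fun z : EuclideanSpace ℝ (Fin K) × S =>
      ∫ z', φ z' ∂coupledKernel V f ε t (m, z.2)) ρ :=
    integrable_of_abs_le (hm.comp hp) fun _ => hMk _
  rw [integral_bind_kernel _ hφ hM, integral_bind_kernel _ hφ hM, Measure.dirac_prod,
    integral_map measurable_prodMk_left.aemeasurable hm.aestronglyMeasurable, Measure.snd,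
    integral_map measurable_snd.aemeasurable hc.aestronglyMeasurable,
    ← integral_sub (integrable_of_abs_le hm hMk) hi]
  refine abs_integral_le_integral_abs.trans ?_
  refine integral_mono_of_nonneg (Eventually.of_forall fun _ => abs_nonneg _) ?_
    (Eventually.of_forall fun z => ?_)
  · refine Integrable.of_bound (C := 2 * M) (Measurable.aestronglyMeasurable (by fun_prop))
      (Eventually.of_forall fun z => ?_)
    have hM0 : 0 ≤ M := (abs_nonneg _).trans (hM z)
    rw [Real.norm_of_nonneg (by positivity)]
    exact min_le_left _ _
  · refine le_min ?_ ?_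
    · refine (abs_sub _ _).trans ?_
      have h1 := hMk z
      have h2 := hMk (m, z.2)
      linarith
    · exact abs_integral_coupledKernel_sub_le hf hconv V ε t hφ hM hL0 hL z.1 m z.2

/-- Finite measures on a product with a metrizable space are determined by the bounded continuous
functions that are uniformly Lipschitz in the first variable. -/
theorem ext_of_forall_lipschitz_fst {E T : Type*} [SeminormedAddCommGroup E] [MeasurableSpace E]
    [BorelSpace E] [SecondCountableTopology E] [TopologicalSpace T]
    [TopologicalSpace.MetrizableSpace T]
    [MeasurableSpace T] [BorelSpace T] {μ ν : Measure (E × T)} [IsFiniteMeasure μ]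
    [IsFiniteMeasure ν]
    (h : ∀ φ : E × T → ℝ, Continuous φ → (∀ z, |φ z| ≤ 1) →
      (∃ L : ℝ, 0 ≤ L ∧ ∀ x x' y, |φ (x, y) - φ (x', y)| ≤ L * ‖x - x'‖) →
      ∫ z, φ z ∂μ = ∫ z, φ z ∂ν) : μ = ν := by
  let := TopologicalSpace.metrizableSpaceMetric T
  have hpos : ∀ n : ℕ, (0 : ℝ) < 1 / (n + 1) := fun n => by positivity
  -- Thickened indicators approximate the indicator of a closed set. They are Lipschitz for the
  -- product metric, in which points with equal second coordinate are at distance `‖x - x'‖`.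
  have key : ∀ F : Set (E × T), IsClosed F → μ F = ν F := by
    intro F hF
    have h1 := tendsto_lintegral_thickenedIndicator_of_isClosed μ hF hpos
      tendsto_one_div_add_atTop_nhds_zero_nat
    have h2 := tendsto_lintegral_thickenedIndicator_of_isClosed ν hF hpos
      tendsto_one_div_add_atTop_nhds_zero_nat
    refine tendsto_nhds_unique h1 (h2.congr fun n => ?_)
    have e := h (fun z => ((thickenedIndicator (hpos n) F z : ℝ≥0) : ℝ))
      (NNReal.continuous_coe.comp (thickenedIndicator (hpos n) F).continuous) (fun z => by
        rw [abs_of_nonneg (NNReal.coe_nonneg _)]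
        exact_mod_cast thickenedIndicator_le_one (hpos n) F z)
      ⟨_, NNReal.coe_nonneg _, fun x x' y => by
        have := (lipschitzWith_thickenedIndicator (hpos n) F).dist_le_mul (x, y) (x', y)
        rw [NNReal.dist_eq, dist_prod_same_right, dist_eq_norm] at this
        exact this⟩
    have hfin : ∀ μ' : Measure (E × T), IsFiniteMeasure μ' →
        ∫⁻ z, thickenedIndicator (hpos n) F z ∂μ' ≠ ∞ := fun μ' _ =>
      ((thickenedIndicator (hpos n) F).lintegral_lt_top_of_nnreal μ').ne
    rw [← BoundedContinuousFunction.toReal_lintegral_coe_eq_integral,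
      ← BoundedContinuousFunction.toReal_lintegral_coe_eq_integral,
      ENNReal.toReal_eq_toReal_iff' (hfin μ inferInstance) (hfin ν inferInstance)] at e
    exact e.symm
  refine ext_of_generate_finite _ ?_ isPiSystem_isClosed (fun F hF => key F hF)
    (key _ isClosed_univ)
  rw [BorelSpace.measurable_eq (α := E × T), borel_eq_generateFrom_isClosed]

end Coupled

section Stationary

variable {K : ℕ} {S : Type u} [TopologicalSpace S] [PolishSpace S] [CompactSpace S]
  [MeasurableSpace S] [BorelSpace S] {f : EuclideanSpace ℝ (Fin K) → S → ℝ} {κ : ℝ}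
  {V : FellerProcess S} {π : Measure S}

/-! ### Uniqueness of the stationary measure -/

/-- The approximating integrals do not involve `ρ`, so two stationary measures must agree on these
test functions. -/
lemma tendsto_integral_of_isStationaryMeasure (hf : IsRegularTarget f) (hκ : 0 < κ)
    (hconv : IsUniformlyStronglyConvex f κ) (hπ : V.IsUniqueInvariant π) {ε : ℝ≥0} (hε : 0 < ε)
    {ρ : Measure (EuclideanSpace ℝ (Fin K) × S)} (hρ : IsStationaryMeasure V f ε ρ)
    {φ : EuclideanSpace ℝ (Fin K) × S → ℝ} (hφ : Measurable φ) {M L : ℝ}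
    (hM : ∀ z, |φ z| ≤ M) (hL0 : 0 ≤ L)
    (hL : ∀ x x' y, |φ (x, y) - φ (x', y)| ≤ L * ‖x - x'‖) :
    Tendsto (fun n : ℕ => ∫ z, φ z ∂((Measure.dirac 0).prod π).bind (coupledKernel V f ε n))
      atTop (𝓝 (∫ z, φ z ∂ρ)) := by
  obtain ⟨hp, hs⟩ := (isStationaryMeasure_iff hf hconv).1 hρ
  have hsnd := snd_eq_of_isStationaryMeasure hf hconv hπ hε hρ
  have hb : ∀ n : ℕ, ‖∫ z, φ z ∂((Measure.dirac 0).prod π).bind (coupledKernel V f ε n) -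
      ∫ z, φ z ∂ρ‖ ≤ ∫ z, min (2 * M) (L * Real.exp (-κ * (n : ℝ≥0)) * ‖z.1 - 0‖) ∂ρ := by
    intro n
    have := abs_integral_bind_sub_le hf hconv V ε n hφ hM hL0 hL ρ 0
    rw [hs, hsnd, abs_sub_comm] at this
    exact this
  rw [tendsto_iff_norm_sub_tendsto_zero]
  refine squeeze_zero (fun _ => norm_nonneg _) hb ?_
  have hlim : ∀ z : EuclideanSpace ℝ (Fin K) × S, Tendsto (fun n : ℕ =>
      min (2 * M) (L * Real.exp (-κ * (n : ℝ≥0)) * ‖z.1 - 0‖)) atTop (𝓝 0) := by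
    intro z
    have hM0 : 0 ≤ M := (abs_nonneg _).trans (hM z)
    have h1 : Tendsto (fun n : ℕ => Real.exp (-κ * (n : ℝ≥0))) atTop (𝓝 0) := by
      refine Real.tendsto_exp_atBot.comp ?_
      simp only [NNReal.coe_natCast, neg_mul]
      exact tendsto_neg_atTop_atBot.comp (tendsto_natCast_atTop_atTop.const_mul_atTop hκ)
    have h2 := tendsto_const_nhds (x := 2 * M) (f := atTop (α := ℕ)) |>.min
      ((h1.const_mul L).mul_const ‖z.1 - 0‖)
    simpa [hM0] using h2
  -- The truncation at `2 * M` supplies the majorant: an arbitrary stationary measure is not known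
  -- to have any moment.
  have := tendsto_integral_of_dominated_convergence (μ := ρ)
    (F := fun (n : ℕ) z => min (2 * M) (L * Real.exp (-κ * (n : ℝ≥0)) * ‖z.1 - 0‖))
    (f := fun _ => 0) (fun _ => 2 * M)
    (fun n => Measurable.aestronglyMeasurable (by fun_prop)) (integrable_const _)
    (fun n => Eventually.of_forall fun z => by
      have hM0 : 0 ≤ M := (abs_nonneg _).trans (hM z)
      rw [Real.norm_of_nonneg (by positivity)]
      exact min_le_left _ _) (Eventually.of_forall hlim)
  simpa using this

theorem IsStationaryMeasure.unique (hf : IsRegularTarget f) (hκ : 0 < κ)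
    (hconv : IsUniformlyStronglyConvex f κ) (hπ : V.IsUniqueInvariant π) {ε : ℝ≥0} (hε : 0 < ε)
    {ρ ρ' : Measure (EuclideanSpace ℝ (Fin K) × S)} (hρ : IsStationaryMeasure V f ε ρ)
    (hρ' : IsStationaryMeasure V f ε ρ') : ρ = ρ' := by
  have := hρ.1
  have := hρ'.1
  refine ext_of_forall_lipschitz_fst fun φ hφ hM ⟨L, hL0, hL⟩ => ?_
  exact tendsto_nhds_unique
    (tendsto_integral_of_isStationaryMeasure hf hκ hconv hπ hε hρ hφ.measurable hM hL0 hL)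
    (tendsto_integral_of_isStationaryMeasure hf hκ hconv hπ hε hρ' hφ.measurable hM hL0 hL)

/-! ### Existence of the stationary measure -/

/-- Functions that are Lipschitz in the first and measurable in the second variable are
approximated by continuous functions, uniformly over all measures with a given second marginal
whose first marginal is concentrated on a given ball. -/
lemma exists_boundedContinuous_integral_sub_le {E : Type*} [NormedAddCommGroup E]
    [ProperSpace E] [MeasurableSpace E] [BorelSpace E]
    [IsFiniteMeasure π] {ψ : E × S → ℝ} (hψ : Measurable ψ) {M L : ℝ} (hM : ∀ z, |ψ z| ≤ M)
    (hL0 : 0 ≤ L) (hL : ∀ x x' y, |ψ (x, y) - ψ (x', y)| ≤ L * ‖x - x'‖) (R : ℝ) {η : ℝ}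
    (hη : 0 < η) :
    ∃ g : BoundedContinuousFunction (E × S) ℝ, ∀ ν : Measure (E × S),
      IsProbabilityMeasure ν → ν.snd = π → (∀ᵐ z ∂ν, ‖z.1‖ ≤ R) → ∫ z, |ψ z - g z| ∂ν ≤ η := by
  obtain ⟨δ, hδ, hδL⟩ : ∃ δ : ℝ, 0 < δ ∧ L * δ ≤ η / 2 := by
    refine ⟨η / (2 * (L + 1)), by positivity, ?_⟩
    rw [mul_div_assoc', div_le_div_iff₀ (by positivity) (by positivity)]
    nlinarith
  -- A partition of unity on finitely many `δ`-balls freezes the first variable at the centres, at a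
  -- cost of `L * δ ≤ η / 2`.
  obtain ⟨t, -, htfin, ht⟩ := (isCompact_closedBall (0 : E) R).finite_cover_balls hδ
  have := htfin.fintype
  obtain ⟨χ, hχ⟩ := PartitionOfUnity.exists_isSubordinate (s := Metric.closedBall (0 : E) R)
    Metric.isClosed_closedBall (fun i : t => Metric.ball (i : E) δ)
    (fun i => Metric.isOpen_ball) (by rwa [biUnion_eq_iUnion] at ht)
  have hη' : 0 < η / (2 * (Fintype.card t + 1)) := by positivity
  -- Each frozen function of the index alone is approximated by a continuous one in `L¹(π)`; these
  -- errors depend on `ν` only through its second marginal. The `+ 1` keeps the denominator positive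
  -- when there are no balls.
  have hw : ∀ i : t, ∃ w : BoundedContinuousFunction S ℝ,
      ∫ y, ‖ψ (i, y) - w y‖ ∂π ≤ η / (2 * (Fintype.card t + 1)) ∧ Integrable w π := fun i =>
    (integrable_of_abs_le (hψ.comp measurable_prodMk_left)
      fun y => hM (i, y)).exists_boundedContinuous_integral_sub_le hη'
  choose w hw hwi using hw
  have hgc : Continuous fun z : E × S => ∑ i, χ i z.1 * w i z.2 := by
    refine continuous_finsetSum _ fun i _ => ?_
    exact ((χ i).continuous.comp continuous_fst).mul ((w i).continuous.comp continuous_snd)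
  refine ⟨BoundedContinuousFunction.ofNormedAddCommGroup _ hgc (∑ i, ‖w i‖) ?_, ?_⟩
  · intro z
    refine (norm_sum_le _ _).trans (Finset.sum_le_sum fun i _ => ?_)
    rw [norm_mul, Real.norm_of_nonneg (χ.nonneg i z.1)]
    calc _ ≤ 1 * ‖w i‖ := mul_le_mul (χ.le_one i z.1) ((w i).norm_coe_le_norm _)
          (norm_nonneg _) zero_le_one
      _ = _ := one_mul _
  intro ν _ hν hνR
  have hwν : ∀ i : t, Integrable (fun z : E × S => |ψ (i, z.2) - w i z.2|) ν ∧
      ∫ z, |ψ (i, z.2) - w i z.2| ∂ν ≤ η / (2 * (Fintype.card t + 1)) := by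
    intro i
    have hi : Integrable (fun y => |ψ (i, y) - w i y|) π :=
      ((integrable_of_abs_le (hψ.comp measurable_prodMk_left)
        fun y => hM (i, y)).sub (hwi i)).abs
    have h1 : ∫ y, |ψ (i, y) - w i y| ∂π ≤ _ := hw i
    rw [← hν] at hi h1
    refine ⟨hi.comp_measurable measurable_snd, ?_⟩
    rwa [Measure.snd, integral_map measurable_snd.aemeasurable hi.1] at h1
  have hpt : ∀ᵐ z ∂ν, |ψ z - ∑ i, χ i z.1 * w i z.2| ≤
      η / 2 + ∑ i : t, |ψ (i, z.2) - w i z.2| := by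
    filter_upwards [hνR] with z hz
    have hsum : ∑ i, χ i z.1 = 1 := by
      rw [← finsum_eq_sum_of_fintype]
      exact χ.sum_eq_one (by simpa using hz)
    have e : ψ z - ∑ i, χ i z.1 * w i z.2 =
        ∑ i, χ i z.1 * (ψ z - ψ (i, z.2)) + ∑ i, χ i z.1 * (ψ (i, z.2) - w i z.2) := by
      rw [← Finset.sum_add_distrib]
      calc _ = (∑ i, χ i z.1) * ψ z - ∑ i, χ i z.1 * w i z.2 := by rw [hsum, one_mul]
        _ = _ := by
          rw [Finset.sum_mul, ← Finset.sum_sub_distrib]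
          exact Finset.sum_congr rfl fun i _ => by ring
    rw [e]
    refine (abs_add_le _ _).trans (add_le_add ?_ ?_)
    · calc |∑ i, χ i z.1 * (ψ z - ψ (i, z.2))|
          ≤ ∑ i, χ i z.1 * (L * δ) := by
            refine (Finset.abs_sum_le_sum_abs _ _).trans (Finset.sum_le_sum fun i _ => ?_)
            rw [abs_mul, abs_of_nonneg (χ.nonneg i z.1)]
            by_cases hi : χ i z.1 = 0
            · simp [hi]
            · have hmem : z.1 ∈ Metric.ball (i : E) δ :=
                hχ i (subset_tsupport _ hi)
              rw [Metric.mem_ball, dist_eq_norm] at hmem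
              refine mul_le_mul_of_nonneg_left ?_ (χ.nonneg i z.1)
              refine (hL z.1 i z.2).trans ?_
              gcongr
        _ = L * δ := by rw [← Finset.sum_mul, hsum, one_mul]
        _ ≤ η / 2 := hδL
    · refine (Finset.abs_sum_le_sum_abs _ _).trans (Finset.sum_le_sum fun i _ => ?_)
      rw [abs_mul, abs_of_nonneg (χ.nonneg i z.1)]
      exact mul_le_of_le_one_left (abs_nonneg _) (χ.le_one i z.1)
  calc ∫ z, |ψ z - ∑ i, χ i z.1 * w i z.2| ∂ν
      ≤ ∫ z, (η / 2 + ∑ i : t, |ψ (i, z.2) - w i z.2|) ∂ν :=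
        integral_mono_of_nonneg (Eventually.of_forall fun _ => abs_nonneg _)
          ((integrable_const _).add (integrable_finsetSum _ fun i _ => (hwν i).1)) hpt
    _ = η / 2 + ∑ i : t, ∫ z, |ψ (i, z.2) - w i z.2| ∂ν := by
        rw [integral_add (integrable_const _) (integrable_finsetSum _ fun i _ => (hwν i).1),
          integral_finsetSum _ fun i _ => (hwν i).1]
        simp
    _ ≤ η / 2 + ∑ _i : t, η / (2 * (Fintype.card t + 1)) := by
        gcongr with i
        exact (hwν i).2
    _ ≤ η := by
        rw [Finset.sum_const, Finset.card_univ, nsmul_eq_mul]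
        have : (Fintype.card t : ℝ) * (η / (2 * (Fintype.card t + 1))) ≤ η / 2 := by
          rw [mul_div_assoc', div_le_div_iff₀ (by positivity) (by positivity)]
          nlinarith
        linarith

/-- The continuous approximant of the previous lemma works for all the measures at once, so weak
convergence extends to test functions merely measurable in the index. This replaces a Feller
property of the coupled kernel. -/
lemma tendsto_integral_of_snd_eq {E : Type*} [NormedAddCommGroup E]
    [ProperSpace E] [MeasurableSpace E] [BorelSpace E]
    [IsFiniteMeasure π] {ψ : E × S → ℝ} (hψ : Measurable ψ) {M L : ℝ} (hM : ∀ z, |ψ z| ≤ M)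
    (hL0 : 0 ≤ L) (hL : ∀ x x' y, |ψ (x, y) - ψ (x', y)| ≤ L * ‖x - x'‖) (R : ℝ)
    {ι : Type*} {l : Filter ι} {ν : ι → ProbabilityMeasure (E × S)}
    {ρ : ProbabilityMeasure (E × S)} (hlim : Tendsto ν l (𝓝 ρ))
    (hν : ∀ i, (ν i : Measure (E × S)).snd = π) (hρ : (ρ : Measure (E × S)).snd = π)
    (hνR : ∀ i, ∀ᵐ z ∂(ν i : Measure (E × S)), ‖z.1‖ ≤ R)
    (hρR : ∀ᵐ z ∂(ρ : Measure (E × S)), ‖z.1‖ ≤ R) :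
    Tendsto (fun i => ∫ z, ψ z ∂(ν i : Measure (E × S))) l
      (𝓝 (∫ z, ψ z ∂(ρ : Measure (E × S)))) := by
  rw [Metric.tendsto_nhds]
  intro η hη
  obtain ⟨g, hg⟩ := exists_boundedContinuous_integral_sub_le (π := π) hψ hM hL0 hL R
    (η := η / 4) (by positivity)
  have hclose : ∀ ν' : Measure (E × S), IsProbabilityMeasure ν' → ν'.snd = π →
      (∀ᵐ z ∂ν', ‖z.1‖ ≤ R) → |∫ z, ψ z ∂ν' - ∫ z, g z ∂ν'| ≤ η / 4 := by
    intro ν' h1 h2 h3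
    rw [← integral_sub (integrable_of_abs_le hψ hM) (g.integrable ν')]
    exact abs_integral_le_integral_abs.trans (hg ν' h1 h2 h3)
  have h1 := (ProbabilityMeasure.tendsto_iff_forall_integral_tendsto.1 hlim) g
  rw [Metric.tendsto_nhds] at h1
  filter_upwards [h1 (η / 4) (by positivity)] with i hi
  have h2 := hclose (ν i) inferInstance (hν i) (hνR i)
  have h3 := hclose ρ inferInstance hρ hρR
  rw [Real.dist_eq] at hi ⊢
  rw [abs_lt] at hi ⊢
  rw [abs_le] at h2 h3
  constructor <;> linarith

lemma ae_norm_fst_coupledKernel_le (hf : IsRegularTarget f) (hκ : 0 < κ)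
    (hconv : IsUniformlyStronglyConvex f κ) {R : ℝ} (hR0 : 0 ≤ R)
    (hR : ∀ y, ‖gradTheta f 0 y‖ ≤ κ * R) (V : FellerProcess S) (ε t : ℝ≥0)
    (z : EuclideanSpace ℝ (Fin K) × S) :
    ∀ᵐ z' ∂coupledKernel V f ε t z, ‖z'.1‖ ≤ ‖z.1‖ + R := by
  rw [coupledKernel_apply hf hconv, coupledLaw,
    ae_map_iff (measurable_coupled_right hf hconv ε t z.1).aemeasurable
      (measurableSet_le measurable_fst.norm measurable_const)]
  exact Eventually.of_forall fun ω =>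
    (sgpc_spec hf ε z.1 ω).norm_le hf hκ hconv hR0 hR t

lemma ae_norm_fst_bind_le (hf : IsRegularTarget f) (hκ : 0 < κ)
    (hconv : IsUniformlyStronglyConvex f κ) {R : ℝ} (hR0 : 0 ≤ R)
    (hR : ∀ y, ‖gradTheta f 0 y‖ ≤ κ * R) (V : FellerProcess S) (ε t : ℝ≥0)
    (π : Measure S) [SFinite π] :
    ∀ᵐ z ∂((Measure.dirac (0 : EuclideanSpace ℝ (Fin K))).prod π).bind (coupledKernel V f ε t),
      ‖z.1‖ ≤ R := by
  have hm : MeasurableSet {z : EuclideanSpace ℝ (Fin K) × S | ¬ ‖z.1‖ ≤ R} :=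
    (measurableSet_le measurable_fst.norm measurable_const).compl
  rw [ae_iff, Measure.bind_apply hm (Kernel.aemeasurable _), Measure.dirac_prod,
    lintegral_map (Kernel.measurable_coe _ hm) measurable_prodMk_left]
  refine lintegral_eq_zero_of_ae_eq_zero (Eventually.of_forall fun y => ?_)
  have := ae_norm_fst_coupledKernel_le hf hκ hconv hR0 hR V ε t (0, y)
  rw [norm_zero, zero_add, ae_iff] at this
  exact this

/-- A limit point of the laws started from `δ₀ ⊗ π` is stationary: confinement to a ball and
compactness of `S` give tightness, and contraction makes `N n` and `N (n + t)` asymptotically equal.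
-/
theorem exists_isStationaryMeasure (hf : IsRegularTarget f) (hκ : 0 < κ)
    (hconv : IsUniformlyStronglyConvex f κ) {R : ℝ} (hR0 : 0 ≤ R)
    (hR : ∀ y, ‖gradTheta f 0 y‖ ≤ κ * R) (hπ : V.IsUniqueInvariant π) (ε : ℝ≥0) :
    ∃ ρ : Measure (EuclideanSpace ℝ (Fin K) × S), IsStationaryMeasure V f ε ρ ∧
      ∀ᵐ z ∂ρ, ‖z.1‖ ≤ R := by
  have := hπ.1.1
  have hmk := isMarkovKernel_coupledKernel hf hconv V ε
  let Z := EuclideanSpace ℝ (Fin K) × S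
  let N : ℝ≥0 → Measure Z := fun t =>
    ((Measure.dirac (0 : EuclideanSpace ℝ (Fin K))).prod π).bind (coupledKernel V f ε t)
  have hN : ∀ t, IsProbabilityMeasure (N t) := fun t => by
    dsimp only [N]
    infer_instance
  have hNadd : ∀ s r, N (s + r) = (N s).bind (coupledKernel V f ε r) := by
    intro s r
    simp only [N]
    rw [coupledKernel_add hf hconv, ← Measure.comp_assoc]
  have hNsnd : ∀ t, (N t).snd = π := by
    intro t
    simp only [N]
    rw [snd_bind_coupledKernel hf hconv, Measure.snd_prod]
    exact hπ.1.bind_eq _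
  have hNR : ∀ t, ∀ᵐ z ∂N t, ‖z.1‖ ≤ R := fun t =>
    ae_norm_fst_bind_le hf hκ hconv hR0 hR V ε t π
  let ν : ℕ → ProbabilityMeasure Z := fun n => ⟨N n, hN n⟩
  have htight : IsTightMeasureSet {x : Measure Z | ∃ μ ∈ range ν, (μ : Measure Z) = x} := by
    rw [isTightMeasureSet_iff_exists_isCompact_measure_compl_le]
    intro η _
    refine ⟨Metric.closedBall 0 R ×ˢ univ,
      (isCompact_closedBall _ _).prod isCompact_univ, ?_⟩
    rintro _ ⟨_, ⟨n, rfl⟩, rfl⟩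
    have h0 : N n (Metric.closedBall 0 R ×ˢ univ)ᶜ = 0 := by
      have := hNR n
      rw [ae_iff] at this
      convert this using 2
      ext z
      rw [mem_compl_iff, mem_prod, mem_closedBall_zero_iff]
      simp
    exact h0.le.trans zero_le
  have hcomp := isCompact_closure_of_isTightMeasureSet htight
  -- A limit along a free ultrafilter replaces a convergent subsequence; limits along `atTop` carry
  -- over to it.
  obtain ⟨ρ, -, hρ⟩ := hcomp.ultrafilter_le_nhds' ((hyperfilter ℕ).map ν)
    (Ultrafilter.mem_map.2 (univ_mem' fun n => subset_closure (mem_range_self n)))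
  have hlim : Tendsto ν (hyperfilter ℕ : Filter ℕ) (𝓝 ρ) := hρ
  have hle : (hyperfilter ℕ : Filter ℕ) ≤ atTop := by
    rw [← Nat.cofinite_eq_atTop]
    exact hyperfilter_le_cofinite
  have hρsnd : (ρ : Measure Z).snd = π := by
    have h1 : Tendsto (fun n => (ν n).map (f := Prod.snd) measurable_snd.aemeasurable)
        (hyperfilter ℕ : Filter ℕ) (𝓝 (ρ.map measurable_snd.aemeasurable)) :=
      ProbabilityMeasure.tendsto_map_of_tendsto_of_continuous ν ρ hlim continuous_snd
    have h2 : ∀ n, (ν n).map (f := Prod.snd) measurable_snd.aemeasurable = ⟨π, hπ.1.1⟩ :=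
      fun n => Subtype.ext (hNsnd n)
    simp_rw [h2] at h1
    have h3 := tendsto_nhds_unique h1 tendsto_const_nhds
    exact congrArg Subtype.val h3
  have hρR : ∀ᵐ z ∂(ρ : Measure Z), ‖z.1‖ ≤ R := by
    have hopen : IsOpen {z : Z | ¬ ‖z.1‖ ≤ R} := by
      simp only [not_le]
      exact isOpen_lt continuous_const (by fun_prop)
    have h1 := ProbabilityMeasure.le_liminf_measure_open_of_tendsto hlim hopen
    rw [ae_iff]
    refine le_antisymm (h1.trans ?_) zero_le
    have h2 : ∀ n, (ν n : Measure Z) {z : Z | ¬ ‖z.1‖ ≤ R} = 0 := fun n => ae_iff.1 (hNR n)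
    simp_rw [h2]
    simp
  refine ⟨ρ, (isStationaryMeasure_iff hf hconv).2 ⟨inferInstance, fun t => ?_⟩, hρR⟩
  refine ext_of_forall_lipschitz_fst fun φ hφ hM ⟨L, hL0, hL⟩ => ?_
  have hψ := measurable_integral_coupledKernel hf hconv V ε t hφ.measurable
  have hψM : ∀ z, |∫ z', φ z' ∂coupledKernel V f ε t z| ≤ 1 := fun z =>
    abs_integral_le_of_abs_le hM
  have h1 := tendsto_integral_of_snd_eq hψ hψM (L := L * Real.exp (-κ * t)) (by positivity)
    (abs_integral_coupledKernel_sub_le hf hconv V ε t hφ.measurable hM hL0 hL) R hlim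
    (fun n => hNsnd n) hρsnd (fun n => hNR n) hρR
  have h2 : Tendsto (fun n => ∫ z, φ z ∂(ν n : Measure Z)) (hyperfilter ℕ : Filter ℕ)
      (𝓝 (∫ z, φ z ∂(ρ : Measure Z))) :=
    (ProbabilityMeasure.tendsto_iff_forall_integral_tendsto.1 hlim)
      (BoundedContinuousFunction.ofNormedAddCommGroup φ hφ 1 hM)
  rw [← integral_bind_kernel _ hφ.measurable hM] at h1
  simp_rw [← integral_bind_kernel (coupledKernel V f ε t) hφ.measurable hM] at h1
  -- Letting time `t` act before time `n` compares `N t` with `δ₀ ⊗ π`, both run for time `n`. They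
  -- share the second marginal, and the first components differ by at most `R`.
  have h3 : ∀ n : ℕ, ‖∫ z, φ z ∂(ν n : Measure Z).bind (coupledKernel V f ε t) -
      ∫ z, φ z ∂(ν n : Measure Z)‖ ≤ L * R * Real.exp (-κ * n) := by
    intro n
    have e : (ν n : Measure Z).bind (coupledKernel V f ε t) =
        (N t).bind (coupledKernel V f ε n) := by
      rw [← hNadd, add_comm, hNadd]
      rfl
    have h := abs_integral_bind_sub_le hf hconv V ε n hφ.measurable hM hL0 hL (N t) 0
    rw [hNsnd t] at h
    rw [e]
    refine h.trans ?_
    have hle : ∀ᵐ z ∂N t, min (2 * 1) (L * Real.exp (-κ * (n : ℝ≥0)) * ‖z.1 - 0‖) ≤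
        L * R * Real.exp (-κ * n) := by
      filter_upwards [hNR t] with z hz
      refine (min_le_right _ _).trans ?_
      rw [sub_zero, NNReal.coe_natCast, mul_right_comm]
      gcongr
    refine (integral_mono_of_nonneg (Eventually.of_forall fun z => ?_)
      (integrable_const _) hle).trans (by simp)
    simp only [Pi.zero_apply]
    positivity
  have h4 : Tendsto (fun n : ℕ => ∫ z, φ z ∂(ν n : Measure Z).bind (coupledKernel V f ε t) -
      ∫ z, φ z ∂(ν n : Measure Z)) atTop (𝓝 0) := by
    refine squeeze_zero_norm h3 ?_
    have h5 : Tendsto (fun n : ℕ => Real.exp (-κ * n)) atTop (𝓝 0) := by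
      refine Real.tendsto_exp_atBot.comp ?_
      simp only [neg_mul]
      exact tendsto_neg_atTop_atBot.comp (tendsto_natCast_atTop_atTop.const_mul_atTop hκ)
    simpa using h5.const_mul (L * R)
  have h5 := tendsto_nhds_unique (h1.sub h2) (h4.mono_left hle)
  linarith

end Stationary

/-! ### The Feller semigroup and the strong Markov property at the meeting time -/

section StrongMarkov

variable {S : Type u} [TopologicalSpace S] [PolishSpace S] [CompactSpace S]
  [MeasurableSpace S] [BorelSpace S] {V : FellerProcess S} {π : Measure S}
  {Ω : Type w} {mΩ : MeasurableSpace Ω} {μ : Measure Ω} {ℱ : Filtration ℝ≥0 mΩ}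
  {X Y : Ω → CadlagPath S}

/-- The transition semigroup `(Q_t h)(x) = 𝔼_x[h(V_t)]`. -/
noncomputable def FellerProcess.semigroup (V : FellerProcess S) (t : ℝ≥0) (h : S → ℝ) (x : S) :
    ℝ :=
  ∫ ω, h (ω t) ∂V.P x

namespace FellerProcess

lemma abs_semigroup_le (V : FellerProcess S) {h : S → ℝ} {M : ℝ} (hM : ∀ x, |h x| ≤ M)
    (t : ℝ≥0) (x : S) : |V.semigroup t h x| ≤ M :=
  abs_integral_le_of_abs_le fun ω => hM (ω t)

lemma measurable_semigroup (V : FellerProcess S) {h : S → ℝ} (hh : Measurable h) :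
    Measurable fun p : ℝ≥0 × S => V.semigroup p.1 h p.2 := by
  have h1 : Measurable fun q : (ℝ≥0 × S) × CadlagPath S => h (q.2 q.1.1) :=
    hh.comp (CadlagPath.measurable_uncurry.comp
      (measurable_snd.prodMk (measurable_fst.comp measurable_fst)))
  have h2 := StronglyMeasurable.integral_kernel_prod_right
    (κ := V.P.comap (Prod.snd : ℝ≥0 × S → S) measurable_snd)
    (f := fun (p : ℝ≥0 × S) (ω : CadlagPath S) => h (ω p.1)) h1.stronglyMeasurable
  exact h2.measurable

lemma continuous_semigroup (V : FellerProcess S) (t : ℝ≥0) {h : S → ℝ} (hh : Continuous h) :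
    Continuous (V.semigroup t h) :=
  V.feller t ⟨h, hh⟩

lemma semigroup_zero (V : FellerProcess S) (h : S → ℝ) (x : S) :
    V.semigroup 0 h x = h x := by
  have : ∀ᵐ ω ∂V.P x, h (ω 0) = h x := (V.ae_start x).mono fun ω hω => by rw [hω]
  rw [semigroup, integral_congr_ae this]
  simp

lemma continuousWithinAt_semigroup (V : FellerProcess S) {h : S → ℝ} (hh : Continuous h)
    (x : S) (t : ℝ≥0) : ContinuousWithinAt (fun r => V.semigroup r h x) (Ici t) t := by
  obtain ⟨M, hM⟩ := isCompact_univ.exists_bound_of_continuousOn hh.continuousOn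
  refine tendsto_integral_filter_of_dominated_convergence (fun _ => M)
    (Eventually.of_forall fun r =>
      (hh.measurable.comp (CadlagPath.measurable_eval r)).aestronglyMeasurable)
    (Eventually.of_forall fun r => Eventually.of_forall fun ω => hM _ (mem_univ _))
    (integrable_const _) (Eventually.of_forall fun ω => ?_)
  exact (hh.tendsto _).comp (ω.continuousWithinAt_Ici t)

end FellerProcess

lemma IsMarkovProcess.setIntegral_eq [IsFiniteMeasure μ]
    (hX : IsMarkovProcess V.transition μ ℱ X) (s t : ℝ≥0) {B : Set Ω}
    (hB : MeasurableSet[ℱ s] B) {h : S → ℝ} (hh : Measurable h) {M : ℝ} (hM : ∀ x, |h x| ≤ M) :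
    ∫ ω in B, h (X ω (s + t)) ∂μ = ∫ ω in B, V.semigroup t h (X ω s) ∂μ := by
  have hm := CadlagPath.measurable_eval (S := S) t
  have hmk : IsMarkovKernel (V.P.map fun ω => ω t) := Kernel.IsMarkovKernel.map _ hm
  have e : (μ.restrict B).map (fun ω => X ω (s + t)) =
      ((μ.restrict B).map (fun ω => X ω s)).bind (V.P.map fun ω => ω t) := by
    ext A hA
    rw [Measure.map_apply (hX.measurable_eval' _) hA,
      Measure.restrict_apply (hX.measurable_eval' _ hA),
      Measure.bind_apply hA (Kernel.aemeasurable _),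
      lintegral_map (Kernel.measurable_coe _ hA) (hX.measurable_eval' _), inter_comm]
    simp_rw [Kernel.map_apply _ hm]
    exact hX.2 s t A hA B hB
  have e2 : ∀ x, ∫ y, h y ∂(V.P.map (fun ω => ω t) x) = V.semigroup t h x := by
    intro x
    rw [Kernel.map_apply _ hm, integral_map hm.aemeasurable hh.aestronglyMeasurable]
    rfl
  have hs : Measurable (V.semigroup t h) := (V.measurable_semigroup hh).comp measurable_prodMk_left
  have e3 := integral_bind_kernel (μ := (μ.restrict B).map (fun ω => X ω s))
    (V.P.map fun ω => ω t) hh hM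
  rw [← e] at e3
  simp_rw [e2] at e3
  rwa [integral_map (hX.measurable_eval' _).aemeasurable hh.aestronglyMeasurable,
    integral_map (hX.measurable_eval' _).aemeasurable hs.aestronglyMeasurable] at e3

lemma FellerProcess.semigroup_semigroup (V : FellerProcess S) (s t : ℝ≥0) {h : S → ℝ}
    (hh : Measurable h) {M : ℝ} (hM : ∀ x, |h x| ≤ M) (x : S) :
    V.semigroup s (V.semigroup t h) x = V.semigroup (s + t) h x := by
  have := IsMarkovProcess.setIntegral_eq (V := V) (X := id) (V.markov x) s t MeasurableSet.univ
    hh hM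
  simp only [Measure.restrict_univ, id] at this
  exact this.symm

/-- The Markov property at a random time with countably many values. -/
lemma IsMarkovProcess.setIntegral_eq_of_countable_range [IsFiniteMeasure μ]
    (hX : IsMarkovProcess V.transition μ ℱ X) (s : ℝ≥0) {A : Set Ω} {τ : Ω → ℝ≥0}
    (hτ : Measurable τ) (hτc : (range τ).Countable) (hA : MeasurableSet A)
    (hAτ : ∀ t, MeasurableSet[ℱ t] (A ∩ τ ⁻¹' {t})) (hle : ∀ ω ∈ A, τ ω ≤ s)
    {h : S → ℝ} (hh : Measurable h) {M : ℝ} (hM : ∀ x, |h x| ≤ M) :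
    ∫ ω in A, h (X ω s) ∂μ = ∫ ω in A, V.semigroup (s - τ ω) h (X ω (τ ω)) ∂μ := by
  have hU : A = ⋃ t : range τ, A ∩ τ ⁻¹' {(t : ℝ≥0)} := by
    ext ω
    simp
  have hd : Pairwise (Function.onFun Disjoint fun t : range τ => A ∩ τ ⁻¹' {(t : ℝ≥0)}) := by
    intro t t' htt
    refine Set.disjoint_left.2 fun ω h1 h2 => htt (Subtype.ext ?_)
    exact h1.2.symm.trans h2.2
  have hmt : ∀ t : range τ, MeasurableSet (A ∩ τ ⁻¹' {(t : ℝ≥0)}) := fun t =>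
    hA.inter (hτ (measurableSet_singleton _))
  have := hτc.to_subtype
  have hi1 : Integrable (fun ω => h (X ω s)) μ :=
    integrable_of_abs_le (hh.comp (hX.measurable_eval' s)) fun _ => hM _
  have hi2 : Integrable (fun ω => V.semigroup (s - τ ω) h (X ω (τ ω))) μ := by
    refine integrable_of_abs_le (M := M) ?_ fun _ => V.abs_semigroup_le hM _ _
    refine (V.measurable_semigroup hh).comp ((measurable_const.sub hτ).prodMk ?_)
    exact CadlagPath.measurable_uncurry.comp (hX.measurable.prodMk hτ)
  rw [hU, integral_iUnion hmt hd hi1.integrableOn, integral_iUnion hmt hd hi2.integrableOn]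
  refine tsum_congr fun t => ?_
  by_cases hts : (t : ℝ≥0) ≤ s
  · have h1 := hX.setIntegral_eq t (s - t) (hAτ t) hh hM
    rw [add_tsub_cancel_of_le hts] at h1
    rw [h1]
    refine setIntegral_congr_fun (hmt t) fun ω hω => ?_
    have : τ ω = t := hω.2
    simp only [this]
  · have : A ∩ τ ⁻¹' {(t : ℝ≥0)} = ∅ := by
      ext ω
      simp only [mem_inter_iff, mem_preimage, mem_singleton_iff, mem_empty_iff_false, iff_false,
        not_and]
      intro hω he
      exact hts (he ▸ hle ω hω)
    rw [this]
    simp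

lemma tendsto_ceil_div (r : ℝ≥0) :
    Tendsto (fun n : ℕ => (⌈(n + 1 : ℝ≥0) * r⌉₊ : ℝ≥0) / (n + 1)) atTop (𝓝[≥] r) := by
  have hlow : ∀ n : ℕ, r ≤ (⌈(n + 1 : ℝ≥0) * r⌉₊ : ℝ≥0) / (n + 1) := fun n => by
    rw [le_div_iff₀ (by positivity), mul_comm]
    exact Nat.le_ceil _
  refine tendsto_nhdsWithin_of_tendsto_nhds_of_eventually_within _ ?_
    (Eventually.of_forall hlow)
  have h1 : Tendsto (fun n : ℕ => r + 1 / ((n : ℝ≥0) + 1)) atTop (𝓝 (r + 0)) :=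
    tendsto_const_nhds.add tendsto_one_div_add_atTop_nhds_zero_nat
  rw [add_zero] at h1
  refine tendsto_of_tendsto_of_tendsto_of_le_of_le tendsto_const_nhds h1 hlow fun n => ?_
  have := (Nat.ceil_lt_add_one (zero_le (a := (n + 1 : ℝ≥0) * r))).le
  have e : (r + 1 / ((n : ℝ≥0) + 1)) * (n + 1) = (n + 1) * r + 1 := by
    rw [add_mul, one_div, inv_mul_cancel₀ (by positivity), mul_comm r]
  rw [div_le_iff₀ (by positivity), e]
  exact this

lemma coe_untopA_of_ne_top {ι : Type*} [Nonempty ι] {a : WithTop ι} (ha : a ≠ ⊤) :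
    (a.untopA : WithTop ι) = a := by
  rw [WithTop.untopA_eq_untop ha, WithTop.coe_untop]

/-- The strong Markov property at a stopping time, for functions along which the semigroup is
Lipschitz in time. -/
lemma IsMarkovProcess.setIntegral_eq_of_isStoppingTime [IsFiniteMeasure μ]
    (hX : IsMarkovProcess V.transition μ ℱ X) {T : Ω → WithTop ℝ≥0} (hT : IsStoppingTime ℱ T)
    (s : ℝ≥0) {h : S → ℝ} (hh : Continuous h) {L : ℝ}
    (hL : ∀ u v x, |V.semigroup u h x - V.semigroup v h x| ≤ L * |(u : ℝ) - v|) :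
    ∫ ω in {ω | T ω ≤ s}, h (X ω s) ∂μ =
      ∫ ω in {ω | T ω ≤ s}, V.semigroup (s - (T ω).untopA) h (X ω (T ω).untopA) ∂μ := by
  obtain ⟨M, hM⟩ := isCompact_univ.exists_bound_of_continuousOn hh.continuousOn
  have hM : ∀ x, |h x| ≤ M := fun x => hM x (mem_univ x)
  have hA : MeasurableSet {ω | T ω ≤ s} := ℱ.le s _ (hT s)
  have hTm : Measurable[hT.measurableSpace] fun ω => (T ω).untopA :=
    WithTop.measurable_untopA.comp hT.measurable
  have hTle := hT.measurableSpace_le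
  -- Times are rounded up to the grid of mesh `1 / (n + 1)` and capped at `s`, so that the
  -- approximation takes countably many values and stays between `T` and `s` on the event
  -- considered.
  let d : ℕ → ℝ≥0 → ℝ≥0 := fun n r => min s ((⌈(n + 1 : ℝ≥0) * r⌉₊ : ℝ≥0) / (n + 1))
  have hdm : ∀ n, Measurable (d n) := fun n => by
    refine measurable_const.min (Measurable.div_const ?_ _)
    exact (measurable_from_top (f := fun k : ℕ => (k : ℝ≥0))).comp
      (Nat.measurable_ceil.comp (measurable_const.mul measurable_id))
  have hdc : ∀ n, (range (d n)).Countable := fun n => by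
    refine (countable_range fun k : ℕ => min s ((k : ℝ≥0) / (n + 1))).mono ?_
    rintro _ ⟨r, rfl⟩
    exact ⟨_, rfl⟩
  have hdlow : ∀ n r, r ≤ s → r ≤ d n r := fun n r hr => by
    refine le_min hr ?_
    rw [le_div_iff₀ (by positivity), mul_comm]
    exact Nat.le_ceil _
  have hdlim : ∀ r, r ≤ s → Tendsto (fun n => d n r) atTop (𝓝[≥] r) := by
    intro r hr
    refine tendsto_nhdsWithin_of_tendsto_nhds_of_eventually_within _ ?_
      (Eventually.of_forall fun n => hdlow n r hr)
    have h1 := (tendsto_const_nhds (x := s) (f := atTop (α := ℕ))).min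
      ((tendsto_ceil_div r).mono_right nhdsWithin_le_nhds)
    rwa [min_eq_right hr] at h1
  have hTs : ∀ ω, T ω ≤ s → T ω = ((T ω).untopA : ℝ≥0) ∧ (T ω).untopA ≤ s := by
    intro ω hω
    have hne : T ω ≠ ⊤ := ne_top_of_le_ne_top WithTop.coe_ne_top hω
    have e : ((T ω).untopA : WithTop ℝ≥0) = T ω := coe_untopA_of_ne_top hne
    refine ⟨e.symm, ?_⟩
    rw [← e] at hω
    exact_mod_cast hω
  have hstep : ∀ n, ∫ ω in {ω | T ω ≤ s}, h (X ω s) ∂μ =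
      ∫ ω in {ω | T ω ≤ s},
        V.semigroup (s - d n (T ω).untopA) h (X ω (d n (T ω).untopA)) ∂μ := by
    intro n
    have hdT : Measurable[hT.measurableSpace] fun ω => d n (T ω).untopA := (hdm n).comp hTm
    refine hX.setIntegral_eq_of_countable_range s (τ := fun ω => d n (T ω).untopA)
      (hdT.mono hTle le_rfl) ((hdc n).mono ?_) hA ?_ ?_ hh.measurable hM
    · rintro _ ⟨ω, rfl⟩
      exact ⟨_, rfl⟩
    · intro t
      by_cases hts : t ≤ s
      -- Rounding upwards forces `T ≤ t` wherever the rounded time equals `t`, which places the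
      -- event in `ℱ t`.
      · have e : {ω | T ω ≤ s} ∩ (fun ω => d n (T ω).untopA) ⁻¹' {t} =
            (fun ω => d n (T ω).untopA) ⁻¹' {t} ∩ {ω | T ω ≤ t} := by
          ext ω
          simp only [mem_inter_iff, mem_preimage, mem_singleton_iff, mem_ofPred_eq]
          constructor
          · rintro ⟨h1, h2⟩
            refine ⟨h2, ?_⟩
            obtain ⟨e1, e2⟩ := hTs ω h1
            rw [e1]
            exact_mod_cast (hdlow n _ e2).trans h2.le
          · rintro ⟨h1, h2⟩
            exact ⟨h2.trans (by exact_mod_cast hts), h1⟩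
        rw [e]
        exact (hdT (measurableSet_singleton t)).2 t
      · have e : {ω | T ω ≤ s} ∩ (fun ω => d n (T ω).untopA) ⁻¹' {t} = ∅ := by
          ext ω
          simp only [mem_inter_iff, mem_preimage, mem_singleton_iff, mem_empty_iff_false,
            iff_false, not_and]
          intro _ h2
          exact hts (h2 ▸ min_le_left _ _)
        rw [e]
        exact @MeasurableSet.empty _ (ℱ t)
    · intro ω _
      exact min_le_left _ _
  refine tendsto_nhds_unique (l := atTop) (f := fun _ : ℕ => ∫ ω in {ω | T ω ≤ s}, h (X ω s) ∂μ)
    tendsto_const_nhds ?_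
  refine Tendsto.congr (fun n => (hstep n).symm) ?_
  have hTm' : Measurable fun ω => (T ω).untopA := hTm.mono hTle le_rfl
  refine tendsto_integral_of_dominated_convergence (fun _ => M) (fun n => ?_)
    (integrable_const _) (fun n => Eventually.of_forall fun ω => V.abs_semigroup_le hM _ _) ?_
  · refine Measurable.aestronglyMeasurable ?_
    have h1 : Measurable fun ω => d n (T ω).untopA := (hdm n).comp hTm'
    exact (V.measurable_semigroup hh.measurable).comp ((measurable_const.sub h1).prodMk
      (CadlagPath.measurable_uncurry.comp (hX.measurable.prodMk h1)))
  · filter_upwards [ae_restrict_mem hA] with ω hω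
    obtain ⟨-, hs⟩ := hTs ω hω
    generalize (T ω).untopA = r at hs
    have h1 : Tendsto (fun n => X ω (d n r)) atTop (𝓝 (X ω r)) :=
      ((X ω).continuousWithinAt_Ici r).tendsto.comp (hdlim r hs)
    -- At the fixed time `s - r`, Feller continuity in the state and right continuity of the path
    -- suffice; the remaining error in time is controlled uniformly in the state by `hL`.
    have h2 : Tendsto (fun n => V.semigroup (s - r) h (X ω (d n r))) atTop
        (𝓝 (V.semigroup (s - r) h (X ω r))) :=
      ((V.continuous_semigroup (s - r) hh).tendsto _).comp h1
    have h3 : Tendsto (fun n => V.semigroup (s - d n r) h (X ω (d n r)) -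
        V.semigroup (s - r) h (X ω (d n r))) atTop (𝓝 0) := by
      refine squeeze_zero_norm (fun n => hL _ _ _) ?_
      have h4 : Tendsto (fun n => ((s - d n r : ℝ≥0) : ℝ) - ((s - r : ℝ≥0) : ℝ)) atTop
          (𝓝 (((s - r : ℝ≥0) : ℝ) - ((s - r : ℝ≥0) : ℝ))) := by
        refine Tendsto.sub ?_ tendsto_const_nhds
        refine (NNReal.continuous_coe.tendsto _).comp ?_
        exact ((by fun_prop : Continuous fun q : ℝ≥0 => s - q).tendsto r).comp
          ((hdlim r hs).mono_right nhdsWithin_le_nhds)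
      simpa using h4.abs.const_mul L
    simpa using h3.add h2

/-! ### Smoothing by time averages -/

/-- `∫_0^η Q_r g dr`. -/
noncomputable def FellerProcess.timeIntegral (V : FellerProcess S) (η : ℝ) (g : S → ℝ) (x : S) :
    ℝ :=
  ∫ r in (0 : ℝ)..η, V.semigroup r.toNNReal g x

namespace FellerProcess

lemma intervalIntegrable_semigroup (V : FellerProcess S) {g : S → ℝ} (hg : Measurable g)
    {M : ℝ} (hM : ∀ x, |g x| ≤ M) (x : S) (a b : ℝ) :
    IntervalIntegrable (fun r : ℝ => V.semigroup r.toNNReal g x) volume a b := by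
  rw [intervalIntegrable_iff]
  refine Measure.integrableOn_of_bounded (M := M) (by simp) ?_
    (Eventually.of_forall fun r => V.abs_semigroup_le hM _ _)
  exact ((V.measurable_semigroup hg).comp
    (measurable_real_toNNReal.prodMk measurable_const)).aestronglyMeasurable

lemma abs_timeIntegral_le (V : FellerProcess S) {g : S → ℝ} {M : ℝ} (hM : ∀ x, |g x| ≤ M)
    {η : ℝ} (hη : 0 ≤ η) (x : S) : |V.timeIntegral η g x| ≤ M * η := by
  have := intervalIntegral.norm_integral_le_of_norm_le_const (a := 0) (b := η)
    (f := fun r : ℝ => V.semigroup r.toNNReal g x) (C := M)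
    fun r _ => V.abs_semigroup_le hM _ _
  rwa [sub_zero, abs_of_nonneg hη] at this

lemma continuous_timeIntegral (V : FellerProcess S) {g : S → ℝ} (hg : Continuous g) {M : ℝ}
    (hM : ∀ x, |g x| ≤ M) (η : ℝ) : Continuous (V.timeIntegral η g) := by
  refine intervalIntegral.continuous_of_dominated_interval (bound := fun _ => M) (fun x => ?_)
    (fun x => Eventually.of_forall fun r _ => V.abs_semigroup_le hM _ _)
    (by simp) (Eventually.of_forall fun r _ => V.continuous_semigroup _ hg)
  exact ((V.measurable_semigroup hg.measurable).comp
    (measurable_real_toNNReal.prodMk measurable_const)).aestronglyMeasurable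

/-- Fubini and the semigroup law turn the action of `Q_u` on a time average into a translation of
the integration window. -/
lemma semigroup_timeIntegral (V : FellerProcess S) {g : S → ℝ} (hg : Measurable g) {M : ℝ}
    (hM : ∀ x, |g x| ≤ M) {η : ℝ} (hη : 0 ≤ η) (u : ℝ≥0) (x : S) :
    V.semigroup u (V.timeIntegral η g) x =
      ∫ r in (u : ℝ)..(u + η), V.semigroup r.toNNReal g x := by
  have hm : Measurable fun p : CadlagPath S × ℝ => V.semigroup p.2.toNNReal g (p.1 u) :=
    (V.measurable_semigroup hg).comp ((measurable_real_toNNReal.comp measurable_snd).prodMk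
      ((CadlagPath.measurable_eval u).comp measurable_fst))
  have h1 : V.semigroup u (V.timeIntegral η g) x =
      ∫ r in Ioc 0 η, ∫ ω, V.semigroup r.toNNReal g (ω u) ∂V.P x := by
    simp only [semigroup, timeIntegral, intervalIntegral.integral_of_le hη]
    refine integral_integral_swap (μ := V.P x) (ν := volume.restrict (Ioc 0 η)) ?_
    exact integrable_of_abs_le hm fun p => V.abs_semigroup_le hM _ _
  have h2 : ∫ r in (u : ℝ)..(u + η), V.semigroup r.toNNReal g x =
      ∫ r in (0 : ℝ)..η, V.semigroup (u + r : ℝ).toNNReal g x := by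
    rw [intervalIntegral.integral_comp_add_left (fun r : ℝ => V.semigroup r.toNNReal g x)]
    simp
  rw [h1, h2, intervalIntegral.integral_of_le hη]
  refine setIntegral_congr_fun measurableSet_Ioc fun r hr => ?_
  have h3 := V.semigroup_semigroup u r.toNNReal hg hM x
  simp only [Real.toNNReal_add u.coe_nonneg hr.1.le, Real.toNNReal_coe]
  exact h3

/-- The two windows differ by two pieces of length at most `|u - v|`. This is the uniform Lipschitz
bound in time required by `IsMarkovProcess.setIntegral_eq_of_isStoppingTime`. -/
lemma abs_semigroup_timeIntegral_sub_le (V : FellerProcess S) {g : S → ℝ} (hg : Measurable g)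
    {M : ℝ} (hM : ∀ x, |g x| ≤ M) {η : ℝ} (hη : 0 ≤ η) (u v : ℝ≥0) (x : S) :
    |V.semigroup u (V.timeIntegral η g) x - V.semigroup v (V.timeIntegral η g) x| ≤
      2 * M * |(u : ℝ) - v| := by
  have hI := V.intervalIntegrable_semigroup hg hM x
  rw [V.semigroup_timeIntegral hg hM hη, V.semigroup_timeIntegral hg hM hη,
    intervalIntegral.integral_interval_sub_interval_comm (hI _ _) (hI _ _) (hI _ _)]
  have hb : ∀ a b : ℝ, |∫ r in a..b, V.semigroup r.toNNReal g x| ≤ M * |b - a| := by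
    intro a b
    rw [← Real.norm_eq_abs (∫ r in a..b, V.semigroup r.toNNReal g x)]
    exact intervalIntegral.norm_integral_le_of_norm_le_const
      fun r _ => V.abs_semigroup_le hM _ _
  have h1 := hb u v
  have h2 := hb (u + η) (v + η)
  rw [add_sub_add_right_eq_sub, abs_sub_comm (v : ℝ)] at h2
  rw [abs_sub_comm (v : ℝ)] at h1
  refine (abs_sub _ _).trans ?_
  linarith

/-- Normalised averages are difference quotients at `0`, where `r ↦ Q_r g x` is right continuous;
hence the smoothing can be removed. -/
lemma tendsto_timeIntegral (V : FellerProcess S) {g : S → ℝ} (hg : Continuous g) {M : ℝ}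
    (hM : ∀ x, |g x| ≤ M) (x : S) :
    Tendsto (fun n : ℕ => (1 / (n + 1 : ℝ))⁻¹ * V.timeIntegral (1 / (n + 1)) g x) atTop
      (𝓝 (g x)) := by
  have hm : Measurable fun r : ℝ => V.semigroup r.toNNReal g x :=
    (V.measurable_semigroup hg.measurable).comp
      (measurable_real_toNNReal.prodMk measurable_const)
  have hc : ContinuousWithinAt (fun r : ℝ => V.semigroup r.toNNReal g x) (Ici 0) 0 := by
    refine ContinuousWithinAt.comp (t := Ici (0 : ℝ).toNNReal)
      (f := fun r : ℝ => r.toNNReal) (g := fun r : ℝ≥0 => V.semigroup r g x)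
      (V.continuousWithinAt_semigroup hg x _) continuous_real_toNNReal.continuousWithinAt ?_
    intro r _
    simp
  have hd : HasDerivWithinAt (fun η => V.timeIntegral η g x)
      (V.semigroup (0 : ℝ).toNNReal g x) (Ici 0) 0 :=
    intervalIntegral.integral_hasDerivWithinAt_right
      (V.intervalIntegrable_semigroup hg.measurable hM x _ _) (t := Ioi 0)
      hm.stronglyMeasurable.stronglyMeasurableAtFilter (hc.mono Ioi_subset_Ici_self)
  rw [Real.toNNReal_zero, V.semigroup_zero] at hd
  have hd' := hd.Ioi_of_Ici
  rw [hasDerivWithinAt_iff_tendsto_slope' (by simp)] at hd'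
  have ht : Tendsto (fun n : ℕ => 1 / (n + 1 : ℝ)) atTop (𝓝[>] 0) :=
    tendsto_nhdsWithin_of_tendsto_nhds_of_eventually_within _
      tendsto_one_div_add_atTop_nhds_zero_nat (Eventually.of_forall fun n => by
        rw [mem_Ioi]; positivity)
  refine (hd'.comp ht).congr fun n => ?_
  simp [slope, timeIntegral]

end FellerProcess

/-! ### The meeting time -/

/-- The infimum is attained: approach it from the right by meeting instants and use right continuity
of both paths. -/
lemma eq_of_meetingTime_eq {ω : Ω} {r : ℝ≥0} (h : meetingTime X Y ω = r) : X ω r = Y ω r := by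
  classical
  rw [meetingTime, hittingAfter_def] at h
  beta_reduce at h
  split_ifs at h with hex
  · have hr : sInf {i : ℝ≥0 | 0 ≤ i ∧ (X ω i, Y ω i) ∈ {p : S × S | p.1 = p.2}} = r := by
      exact_mod_cast h
    obtain ⟨q, hqlim, hqmem⟩ : ∃ q : ℕ → ℝ≥0, Tendsto q atTop (𝓝[≥] r) ∧
        ∀ n, X ω (q n) = Y ω (q n) := by
      have hne : {i : ℝ≥0 | 0 ≤ i ∧ (X ω i, Y ω i) ∈ {p : S × S | p.1 = p.2}}.Nonempty := hex
      obtain ⟨q, -, hq1, hq2⟩ := exists_seq_tendsto_sInf hne (OrderBot.bddBelow _)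
      rw [hr] at hq1
      refine ⟨q, tendsto_nhdsWithin_of_tendsto_nhds_of_eventually_within _ hq1
        (Eventually.of_forall fun n => ?_), fun n => (hq2 n).2⟩
      rw [mem_Ici, ← hr]
      exact csInf_le (OrderBot.bddBelow _) (hq2 n)
    have h1 := ((X ω).continuousWithinAt_Ici r).tendsto.comp hqlim
    have h2 := ((Y ω).continuousWithinAt_Ici r).tendsto.comp hqlim
    refine tendsto_nhds_unique h1 (h2.congr fun n => ?_)
    exact (hqmem n).symm
  · exact absurd h.symm WithTop.coe_ne_top

/-- After the meeting time the two processes have the same law. -/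
theorem map_restrict_meetingTime_le [IsFiniteMeasure μ]
    (hX : IsMarkovProcess V.transition μ ℱ X) (hY : IsMarkovProcess V.transition μ ℱ Y)
    (hT : IsStoppingTime ℱ (meetingTime X Y)) (s : ℝ≥0) :
    (μ.restrict {ω | meetingTime X Y ω ≤ s}).map (fun ω => X ω s) =
      (μ.restrict {ω | meetingTime X Y ω ≤ s}).map (fun ω => Y ω s) := by
  have hA : MeasurableSet {ω | meetingTime X Y ω ≤ s} := ℱ.le s _ (hT s)
  refine ext_of_forall_integral_eq_of_IsFiniteMeasure fun g => ?_
  have hg := g.continuous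
  have hM : ∀ x, |g x| ≤ ‖g‖ := fun x => g.norm_coe_le_norm x
  rw [integral_map (hX.measurable_eval' s).aemeasurable hg.measurable.aestronglyMeasurable,
    integral_map (hY.measurable_eval' s).aemeasurable hg.measurable.aestronglyMeasurable]
  have key : ∀ n : ℕ, ∫ ω in {ω | meetingTime X Y ω ≤ s},
        (1 / (n + 1 : ℝ))⁻¹ * V.timeIntegral (1 / (n + 1)) g (X ω s) ∂μ =
      ∫ ω in {ω | meetingTime X Y ω ≤ s},
        (1 / (n + 1 : ℝ))⁻¹ * V.timeIntegral (1 / (n + 1)) g (Y ω s) ∂μ := by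
    intro n
    have hη : (0 : ℝ) ≤ 1 / (n + 1) := by positivity
    have hc := V.continuous_timeIntegral hg hM (1 / (n + 1 : ℝ))
    have hL := V.abs_semigroup_timeIntegral_sub_le hg.measurable hM hη
    rw [integral_const_mul, integral_const_mul, hX.setIntegral_eq_of_isStoppingTime hT s hc hL,
      hY.setIntegral_eq_of_isStoppingTime hT s hc hL]
    congr 1
    -- After the strong Markov property each side depends only on the state at the meeting time,
    -- which is common to both processes.
    refine setIntegral_congr_fun hA fun ω hω => ?_
    have hne : meetingTime X Y ω ≠ ⊤ := ne_top_of_le_ne_top WithTop.coe_ne_top hω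
    have := eq_of_meetingTime_eq (X := X) (Y := Y) (coe_untopA_of_ne_top hne).symm
    simp only [this]
  have hlim : ∀ {Z : Ω → CadlagPath S}, IsMarkovProcess V.transition μ ℱ Z →
      Tendsto (fun n : ℕ => ∫ ω in {ω | meetingTime X Y ω ≤ s},
        (1 / (n + 1 : ℝ))⁻¹ * V.timeIntegral (1 / (n + 1)) g (Z ω s) ∂μ) atTop
        (𝓝 (∫ ω in {ω | meetingTime X Y ω ≤ s}, g (Z ω s) ∂μ)) := by
    intro Z hZ
    refine tendsto_integral_of_dominated_convergence (fun _ => ‖g‖) (fun n => ?_)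
      (integrable_const _) (fun n => Eventually.of_forall fun ω => ?_)
      (Eventually.of_forall fun ω => V.tendsto_timeIntegral hg hM _)
    · exact (((V.continuous_timeIntegral hg hM _).measurable.comp
        (hZ.measurable_eval' s)).const_mul _).aestronglyMeasurable
    · have hη : (0 : ℝ) < 1 / (n + 1) := by positivity
      rw [norm_mul, Real.norm_of_nonneg (inv_nonneg.2 hη.le), inv_mul_le_iff₀ hη, mul_comm]
      exact V.abs_timeIntegral_le hM hη.le _
  refine tendsto_nhds_unique (hlim hX) ?_
  simp_rw [key]
  exact hlim hY

/-- A coupling of the law of `X_s` and the law of `Y_s` under which the two coordinates agree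
unless the processes have not met by time `s`. -/
theorem exists_coupling_of_meetingTime [IsProbabilityMeasure μ]
    (hX : IsMarkovProcess V.transition μ ℱ X) (hY : IsMarkovProcess V.transition μ ℱ Y)
    (hT : IsStoppingTime ℱ (meetingTime X Y)) (s : ℝ≥0) :
    ∃ Λ : Measure (S × S), IsProbabilityMeasure Λ ∧ Λ.fst = μ.map (fun ω => X ω s) ∧
      Λ.snd = μ.map (fun ω => Y ω s) ∧
      Λ {p | p.1 ≠ p.2} ≤ μ {ω | (s : WithTop ℝ≥0) ≤ meetingTime X Y ω} := by
  classical
  let A : Set Ω := {ω | meetingTime X Y ω ≤ s}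
  have hA : MeasurableSet A := ℱ.le s _ (hT s)
  -- `Y'` equals `X` once the processes have met and `Y` otherwise. It has the law of `Y` at time
  -- `s` because the laws restricted to the meeting event coincide.
  let Y' : Ω → S := A.piecewise (fun ω => X ω s) (fun ω => Y ω s)
  have hXm := hX.measurable_eval' s
  have hYm := hY.measurable_eval' s
  have hY' : Measurable Y' := hXm.piecewise hA hYm
  have hm : Measurable fun ω => (X ω s, Y' ω) := hXm.prodMk hY'
  refine ⟨μ.map fun ω => (X ω s, Y' ω), Measure.isProbabilityMeasure_map hm.aemeasurable,
    ?_, ?_, ?_⟩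
  · rw [Measure.fst, Measure.map_map measurable_fst hm]
    rfl
  · rw [Measure.snd, Measure.map_map measurable_snd hm]
    change μ.map Y' = _
    have h1 := map_restrict_meetingTime_le hX hY hT s
    ext B hB
    have h2 := congrArg (fun ν : Measure S => ν B) h1
    beta_reduce at h2
    rw [Measure.map_apply hXm hB, Measure.map_apply hYm hB, Measure.restrict_apply (hXm hB),
      Measure.restrict_apply (hYm hB)] at h2
    rw [Measure.map_apply hY' hB, Measure.map_apply hYm hB,
      ← measure_inter_add_sdiff _ hA, ← measure_inter_add_sdiff ((fun ω => Y ω s) ⁻¹' B) hA]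
    congr 1
    · rw [← h2]
      congr 1
      ext ω
      simp only [mem_inter_iff, mem_preimage]
      refine and_congr_left fun hω => ?_
      simp [Y', piecewise_eq_of_mem _ _ _ hω]
    · congr 1
      ext ω
      refine and_congr_left fun hω => ?_
      simp [Y', piecewise_eq_of_notMem _ _ _ hω]
  · have hD : MeasurableSet {p : S × S | p.1 ≠ p.2} :=
      (measurableSet_eq_fun measurable_fst measurable_snd).compl
    rw [Measure.map_apply hm hD]
    refine measure_mono fun ω hω => ?_
    by_contra hcon
    have hmem : ω ∈ A := by
      rw [mem_ofPred_eq, not_le] at hcon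
      exact hcon.le
    exact hω (by simp [Y', piecewise_eq_of_mem _ _ _ hmem])

end StrongMarkov

section Wasserstein

variable {K : ℕ} {S : Type u} [TopologicalSpace S] [PolishSpace S] [CompactSpace S]
  [MeasurableSpace S] [BorelSpace S] {f : EuclideanSpace ℝ (Fin K) → S → ℝ} {κ : ℝ}
  {V : FellerProcess S} {π : Measure S}

/-! ### Couplings -/

lemma couplingDist_le_one (z z' : EuclideanSpace ℝ (Fin K) × S) : couplingDist z z' ≤ 1 := by
  rw [couplingDist]
  split_ifs
  · exact min_le_left _ _
  · exact le_rfl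

lemma couplingDist_le_norm {z z' : EuclideanSpace ℝ (Fin K) × S} (h : z.2 = z'.2) :
    couplingDist z z' ≤ ‖z.1 - z'.1‖ := by
  rw [couplingDist, if_pos h]
  exact min_le_right _ _

lemma measurable_couplingDist :
    Measurable fun p : (EuclideanSpace ℝ (Fin K) × S) × (EuclideanSpace ℝ (Fin K) × S) =>
      couplingDist p.1 p.2 := by
  unfold couplingDist
  refine Measurable.ite ?_ ?_ measurable_const
  · exact measurableSet_eq_fun (measurable_snd.comp measurable_fst)
      (measurable_snd.comp measurable_snd)
  · exact measurable_const.min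
      ((measurable_fst.comp measurable_fst).sub (measurable_fst.comp measurable_snd)).norm

lemma wassersteinDist_map_le {Ω : Type*} [MeasurableSpace Ω] (P : Measure Ω)
    {Z Z' : Ω → EuclideanSpace ℝ (Fin K) × S} (hZ : Measurable Z) (hZ' : Measurable Z') :
    wassersteinDist (P.map Z) (P.map Z') ≤
      ∫⁻ ω, ENNReal.ofReal (couplingDist (Z ω) (Z' ω)) ∂P := by
  have hm : Measurable fun ω => (Z ω, Z' ω) := hZ.prodMk hZ'
  have hc : (P.map fun ω => (Z ω, Z' ω)).map Prod.fst = P.map Z ∧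
      (P.map fun ω => (Z ω, Z' ω)).map Prod.snd = P.map Z' := by
    rw [Measure.map_map measurable_fst hm, Measure.map_map measurable_snd hm]
    exact ⟨rfl, rfl⟩
  refine (iInf₂_le (P.map fun ω => (Z ω, Z' ω)) hc).trans ?_
  rw [lintegral_map measurable_couplingDist.ennreal_ofReal hm]

/-- Two measures on `E × S` can be coupled over a given coupling of their second marginals. -/
theorem exists_coupling_over {E T : Type*} [MeasurableSpace E] [StandardBorelSpace E]
    [Nonempty E] [MeasurableSpace T] {α β : Measure (E × T)} [IsProbabilityMeasure α]
    [IsProbabilityMeasure β] {Λ : Measure (T × T)} [IsProbabilityMeasure Λ]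
    (hα : Λ.fst = α.snd) (hβ : Λ.snd = β.snd) :
    ∃ Γ : Measure ((E × T) × (E × T)), IsProbabilityMeasure Γ ∧ Γ.fst = α ∧ Γ.snd = β ∧
      Γ.map (fun p => (p.1.2, p.2.2)) = Λ := by
  let kα : Kernel T E := (α.map Prod.swap).condKernel
  let kβ : Kernel T E := (β.map Prod.swap).condKernel
  have := Measure.isProbabilityMeasure_map (μ := α) measurable_swap.aemeasurable
  have := Measure.isProbabilityMeasure_map (μ := β) measurable_swap.aemeasurable
  have hdis : ∀ (γ : Measure (E × T)) [IsProbabilityMeasure γ]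
      [IsProbabilityMeasure (γ.map Prod.swap)] {φ : E × T → ℝ≥0∞}, Measurable φ →
      ∫⁻ v, ∫⁻ x, φ (x, v) ∂(γ.map Prod.swap).condKernel v ∂γ.snd = ∫⁻ z, φ z ∂γ := by
    intro γ _ _ φ hφ
    have h1 : (γ.map Prod.swap).fst = γ.snd := by
      rw [Measure.fst, Measure.map_map measurable_fst measurable_swap]
      rfl
    have hφs : Measurable fun q : T × E => φ q.swap := hφ.comp measurable_swap
    have h2 := (γ.map Prod.swap).disintegrate (γ.map Prod.swap).condKernel
    rw [h1] at h2
    calc _ = ∫⁻ q, φ q.swap ∂(γ.snd ⊗ₘ (γ.map Prod.swap).condKernel) :=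
          (Measure.lintegral_compProd hφs).symm
      _ = ∫⁻ q, φ q.swap ∂(γ.map Prod.swap) := by rw [h2]
      _ = ∫⁻ z, φ z ∂γ := by
          rw [lintegral_map hφs measurable_swap]
          simp
  -- Given a pair of indices drawn from `Λ`, the first components are drawn independently from their
  -- conditional laws.
  let η : Kernel (T × T) (E × E) :=
    kα.comap Prod.fst measurable_fst ×ₖ kβ.comap Prod.snd measurable_snd
  let g : (T × T) × (E × E) → (E × T) × (E × T) := fun q => ((q.2.1, q.1.1), (q.2.2, q.1.2))
  have hg : Measurable g := by fun_prop
  refine ⟨(Λ ⊗ₘ η).map g, Measure.isProbabilityMeasure_map hg.aemeasurable, ?_, ?_, ?_⟩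
  · refine Measure.ext_of_lintegral _ fun φ hφ => ?_
    have hm : Measurable fun q : (T × T) × (E × E) => φ (q.2.1, q.1.1) := by fun_prop
    have hk : Measurable fun v : T => ∫⁻ x, φ (x, v) ∂kα v :=
      Measurable.lintegral_kernel_prod_right' (f := fun q : T × E => φ (q.2, q.1)) (by fun_prop)
    rw [Measure.fst, Measure.map_map measurable_fst hg,
      lintegral_map hφ (measurable_fst.comp hg), ← hdis α hφ, ← hα, Measure.fst,
      lintegral_map hk measurable_fst]
    refine (Measure.lintegral_compProd hm).trans (lintegral_congr fun v => ?_)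
    have hm' : Measurable fun y : E × E => φ (y.1, v.1) := by fun_prop
    rw [Kernel.prod_apply, lintegral_prod _ hm'.aemeasurable]
    simp [kα]
  · refine Measure.ext_of_lintegral _ fun φ hφ => ?_
    have hm : Measurable fun q : (T × T) × (E × E) => φ (q.2.2, q.1.2) := by fun_prop
    have hk : Measurable fun v : T => ∫⁻ x, φ (x, v) ∂kβ v :=
      Measurable.lintegral_kernel_prod_right' (f := fun q : T × E => φ (q.2, q.1)) (by fun_prop)
    rw [Measure.snd, Measure.map_map measurable_snd hg,
      lintegral_map hφ (measurable_snd.comp hg), ← hdis β hφ, ← hβ, Measure.snd,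
      lintegral_map hk measurable_snd]
    refine (Measure.lintegral_compProd hm).trans (lintegral_congr fun v => ?_)
    have hm' : Measurable fun y : E × E => φ (y.2, v.2) := by fun_prop
    rw [Kernel.prod_apply, lintegral_prod _ hm'.aemeasurable]
    simp [kβ]
  · rw [Measure.map_map (by fun_prop) hg]
    change (Λ ⊗ₘ η).map Prod.fst = Λ
    exact Measure.fst_compProd _ _

/-! ### The coupling bounds -/

/-- Running both processes along one index path contracts the first components. -/
theorem wassersteinDist_lawFrom_le (hf : IsRegularTarget f)
    (hconv : IsUniformlyStronglyConvex f κ) {ε : ℝ≥0}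
    {ρ : Measure (EuclideanSpace ℝ (Fin K) × S)} (hρ : IsStationaryMeasure V f ε ρ)
    (hsnd : ρ.snd = π) (m : EuclideanSpace ℝ (Fin K)) (t : ℝ≥0) :
    wassersteinDist (coupledLaw f ε t m (V.lawFrom π)) ρ ≤
      ∫⁻ z, ENNReal.ofReal (Real.exp (-κ * t) * ‖z.1 - m‖) ∂ρ := by
  obtain ⟨hp, hs⟩ := (isStationaryMeasure_iff hf hconv).1 hρ
  -- A stationary state `z` is drawn together with a single index path started at `z.2`; since `z.2`
  -- has law `π`, this path also drives the copy started at `m`.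
  let P : Measure ((EuclideanSpace ℝ (Fin K) × S) × CadlagPath S) :=
    ρ ⊗ₘ V.P.comap Prod.snd measurable_snd
  have hZ : Measurable fun q : (EuclideanSpace ℝ (Fin K) × S) × CadlagPath S =>
      (sgpc f ε m q.2 t, q.2 (t / ε)) :=
    (measurable_coupled_right hf hconv ε t m).comp measurable_snd
  have hZ' : Measurable fun q : (EuclideanSpace ℝ (Fin K) × S) × CadlagPath S =>
      (sgpc f ε q.1.1 q.2 t, q.2 (t / ε)) :=
    (measurable_coupled hf hconv ε t).comp
      ((measurable_fst.comp measurable_fst).prodMk measurable_snd)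
  have e1 : P.map (fun q => (sgpc f ε m q.2 t, q.2 (t / ε))) =
      coupledLaw f ε t m (V.lawFrom π) := by
    have : IsProbabilityMeasure π := hsnd ▸ inferInstance
    rw [coupledLaw_lawFrom hf hconv, ← hsnd]
    refine Measure.ext_of_lintegral _ fun φ hφ => ?_
    have hk : Measurable fun y : S => ∫⁻ z, φ z ∂coupledKernel V f ε t (m, y) :=
      hφ.lintegral_kernel.comp measurable_prodMk_left
    rw [lintegral_map hφ hZ, Measure.lintegral_bind (Kernel.aemeasurable _) hφ.aemeasurable,
      Measure.dirac_prod, lintegral_map hφ.lintegral_kernel measurable_prodMk_left, Measure.snd,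
      lintegral_map hk measurable_snd]
    refine (Measure.lintegral_compProd (hφ.comp hZ)).trans (lintegral_congr fun z => ?_)
    rw [lintegral_coupledKernel hf hconv V ε t _ hφ]
    rfl
  have e2 : P.map (fun q => (sgpc f ε q.1.1 q.2 t, q.2 (t / ε))) = ρ := by
    refine Eq.trans ?_ (hs t)
    refine Measure.ext_of_lintegral _ fun φ hφ => ?_
    rw [lintegral_map hφ hZ', Measure.lintegral_bind (Kernel.aemeasurable _) hφ.aemeasurable]
    refine (Measure.lintegral_compProd (hφ.comp hZ')).trans (lintegral_congr fun z => ?_)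
    rw [lintegral_coupledKernel hf hconv V ε t _ hφ]
    rfl
  have hm : Measurable fun z : EuclideanSpace ℝ (Fin K) × S =>
      ENNReal.ofReal (Real.exp (-κ * t) * ‖z.1 - m‖) := by fun_prop
  calc wassersteinDist (coupledLaw f ε t m (V.lawFrom π)) ρ
      = wassersteinDist (P.map fun q => (sgpc f ε m q.2 t, q.2 (t / ε)))
          (P.map fun q => (sgpc f ε q.1.1 q.2 t, q.2 (t / ε))) := by rw [e1, e2]
    _ ≤ ∫⁻ q, ENNReal.ofReal (couplingDist (sgpc f ε m q.2 t, q.2 (t / ε))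
          (sgpc f ε q.1.1 q.2 t, q.2 (t / ε))) ∂P := wassersteinDist_map_le P hZ hZ'
    _ ≤ ∫⁻ q, ENNReal.ofReal (Real.exp (-κ * t) * ‖q.1.1 - m‖) ∂P := by
        refine lintegral_mono fun q => ENNReal.ofReal_le_ofReal ?_
        have h1 : couplingDist (sgpc f ε m q.2 t, q.2 (t / ε))
            (sgpc f ε q.1.1 q.2 t, q.2 (t / ε)) ≤ ‖sgpc f ε m q.2 t - sgpc f ε q.1.1 q.2 t‖ :=
          couplingDist_le_norm rfl
        refine h1.trans ?_
        rw [norm_sub_rev q.1.1 m]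
        exact norm_sgpc_sub_le hf hconv ε _ _ _ t
    _ = ∫⁻ z, ENNReal.ofReal (Real.exp (-κ * t) * ‖z.1 - m‖) ∂ρ := by
        refine (Measure.lintegral_compProd (hm.comp measurable_fst)).trans ?_
        simp

/-- The state space of the coupled process. -/
abbrev CoupledState (K : ℕ) (S : Type u) : Type u := EuclideanSpace ℝ (Fin K) × S

/-- Starting from a coupling `Γ`, run both processes along the same index path where the indices
agree, and along independent index paths elsewhere. -/
theorem wassersteinDist_bind_le (hf : IsRegularTarget f)
    (hconv : IsUniformlyStronglyConvex f κ) (V : FellerProcess S) (ε r : ℝ≥0)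
    (Γ : Measure (CoupledState K S × CoupledState K S))
    [IsProbabilityMeasure Γ] {D : ℝ} (hD : ∀ᵐ p ∂Γ, ‖p.1.1 - p.2.1‖ ≤ D) :
    wassersteinDist (Γ.fst.bind (coupledKernel V f ε r)) (Γ.snd.bind (coupledKernel V f ε r)) ≤
      ENNReal.ofReal (Real.exp (-κ * r) * D) + Γ {p | p.1.2 ≠ p.2.2} := by
  classical
  let η : Kernel (CoupledState K S × CoupledState K S) (CadlagPath S × CadlagPath S) :=
    V.P.comap (fun p : CoupledState K S × CoupledState K S => p.1.2) (by fun_prop) ×ₖ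
      V.P.comap (fun p : CoupledState K S × CoupledState K S => p.2.2) (by fun_prop)
  have hηm : IsMarkovKernel η := by
    dsimp only [η]
    infer_instance
  let P : Measure ((CoupledState K S × CoupledState K S) × (CadlagPath S × CadlagPath S)) := Γ ⊗ₘ η
  -- Where the initial indices agree the second process borrows the path of the first. Its law is
  -- unchanged, as both paths start at the same point, and the indices then stay equal.
  let path : (CoupledState K S × CoupledState K S) × (CadlagPath S × CadlagPath S) → CadlagPath S := fun q =>
    if q.1.1.2 = q.1.2.2 then q.2.1 else q.2.2
  have hdiag : MeasurableSet {p : CoupledState K S × CoupledState K S | p.1.2 = p.2.2} :=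
    measurableSet_eq_fun (by fun_prop) (by fun_prop)
  have hpath : Measurable path :=
    Measurable.ite (hdiag.preimage measurable_fst) (by fun_prop) (by fun_prop)
  have hZ : Measurable fun q : (CoupledState K S × CoupledState K S) × (CadlagPath S × CadlagPath S) =>
      (sgpc f ε q.1.1.1 q.2.1 r, q.2.1 (r / ε)) :=
    (measurable_coupled hf hconv ε r).comp
      (f := fun q : (CoupledState K S × CoupledState K S) × (CadlagPath S × CadlagPath S) =>
        (q.1.1.1, q.2.1)) (by fun_prop)
  have hZ' : Measurable fun q : (CoupledState K S × CoupledState K S) × (CadlagPath S × CadlagPath S) =>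
      (sgpc f ε q.1.2.1 (path q) r, path q (r / ε)) :=
    (measurable_coupled hf hconv ε r).comp
      (f := fun q : (CoupledState K S × CoupledState K S) × (CadlagPath S × CadlagPath S) =>
        (q.1.2.1, path q)) (Measurable.prodMk (by fun_prop) hpath)
  have e1 : P.map (fun q => (sgpc f ε q.1.1.1 q.2.1 r, q.2.1 (r / ε))) =
      Γ.fst.bind (coupledKernel V f ε r) := by
    refine Measure.ext_of_lintegral _ fun φ hφ => ?_
    rw [lintegral_map hφ hZ, Measure.lintegral_bind (Kernel.aemeasurable _) hφ.aemeasurable,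
      Measure.fst, lintegral_map hφ.lintegral_kernel measurable_fst]
    refine (Measure.lintegral_compProd (hφ.comp hZ)).trans (lintegral_congr fun p => ?_)
    have hm : Measurable fun y : CadlagPath S × CadlagPath S =>
        φ (sgpc f ε p.1.1 y.1 r, y.1 (r / ε)) :=
      hφ.comp ((measurable_coupled_right hf hconv ε r p.1.1).comp measurable_fst)
    rw [lintegral_coupledKernel hf hconv V ε r _ hφ]
    simp only [η, Kernel.prod_apply, Kernel.comap_apply]
    refine (lintegral_prod _ hm.aemeasurable).trans ?_
    simp
  have e2 : P.map (fun q => (sgpc f ε q.1.2.1 (path q) r, path q (r / ε))) =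
      Γ.snd.bind (coupledKernel V f ε r) := by
    refine Measure.ext_of_lintegral _ fun φ hφ => ?_
    rw [lintegral_map hφ hZ', Measure.lintegral_bind (Kernel.aemeasurable _) hφ.aemeasurable,
      Measure.snd, lintegral_map hφ.lintegral_kernel measurable_snd]
    refine (Measure.lintegral_compProd (hφ.comp hZ')).trans (lintegral_congr fun p => ?_)
    rw [lintegral_coupledKernel hf hconv V ε r _ hφ]
    simp only [η, Kernel.prod_apply, Kernel.comap_apply]
    have hm : Measurable fun ω : CadlagPath S => φ (sgpc f ε p.2.1 ω r, ω (r / ε)) :=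
      hφ.comp (measurable_coupled_right hf hconv ε r p.2.1)
    by_cases hp : p.1.2 = p.2.2
    · have e : ∀ y : CadlagPath S × CadlagPath S,
          φ (sgpc f ε p.2.1 (path (p, y)) r, path (p, y) (r / ε)) =
            φ (sgpc f ε p.2.1 y.1 r, y.1 (r / ε)) := fun y => by
        rw [show path (p, y) = y.1 from if_pos hp]
      refine (lintegral_congr e).trans ?_
      refine (lintegral_prod _ (hm.comp measurable_fst).aemeasurable).trans ?_
      simp [hp]
    · have e : ∀ y : CadlagPath S × CadlagPath S,
          φ (sgpc f ε p.2.1 (path (p, y)) r, path (p, y) (r / ε)) =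
            φ (sgpc f ε p.2.1 y.2 r, y.2 (r / ε)) := fun y => by
        rw [show path (p, y) = y.2 from if_neg hp]
      refine (lintegral_congr e).trans ?_
      refine (lintegral_prod _ (hm.comp measurable_snd).aemeasurable).trans ?_
      simp
  have hD' : ∀ᵐ q ∂P, ‖q.1.1.1 - q.1.2.1‖ ≤ D := by
    have hfst : P.map Prod.fst = Γ := Measure.fst_compProd _ _
    rw [← hfst] at hD
    exact ae_of_ae_map measurable_fst.aemeasurable hD
  calc wassersteinDist (Γ.fst.bind (coupledKernel V f ε r)) (Γ.snd.bind (coupledKernel V f ε r))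
      = wassersteinDist (P.map fun q => (sgpc f ε q.1.1.1 q.2.1 r, q.2.1 (r / ε)))
          (P.map fun q => (sgpc f ε q.1.2.1 (path q) r, path q (r / ε))) := by rw [e1, e2]
    _ ≤ ∫⁻ q, ENNReal.ofReal (couplingDist (sgpc f ε q.1.1.1 q.2.1 r, q.2.1 (r / ε))
          (sgpc f ε q.1.2.1 (path q) r, path q (r / ε))) ∂P := wassersteinDist_map_le P hZ hZ'
    _ ≤ ∫⁻ q, (ENNReal.ofReal (Real.exp (-κ * r) * D) +
          {p : CoupledState K S × CoupledState K S | p.1.2 = p.2.2}ᶜ.indicator 1 q.1) ∂P := by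
        refine lintegral_mono_ae ?_
        filter_upwards [hD'] with q hq
        by_cases hp : q.1.1.2 = q.1.2.2
        · have hpq : path q = q.2.1 := if_pos hp
          rw [hpq]
          refine le_add_right (ENNReal.ofReal_le_ofReal ?_)
          have h1 : couplingDist (sgpc f ε q.1.1.1 q.2.1 r, q.2.1 (r / ε))
              (sgpc f ε q.1.2.1 q.2.1 r, q.2.1 (r / ε)) ≤
              ‖sgpc f ε q.1.1.1 q.2.1 r - sgpc f ε q.1.2.1 q.2.1 r‖ := couplingDist_le_norm rfl
          exact h1.trans ((norm_sgpc_sub_le hf hconv ε _ _ _ r).trans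
            (mul_le_mul_of_nonneg_left hq (Real.exp_pos _).le))
        · refine le_add_left ?_
          rw [indicator_of_mem (by exact hp), Pi.one_apply, ← ENNReal.ofReal_one]
          exact ENNReal.ofReal_le_ofReal (couplingDist_le_one _ _)
    _ = ENNReal.ofReal (Real.exp (-κ * r) * D) + Γ {p | p.1.2 ≠ p.2.2} := by
        have hi : Measurable fun p : CoupledState K S × CoupledState K S =>
            {p : CoupledState K S × CoupledState K S | p.1.2 = p.2.2}ᶜ.indicator (1 : CoupledState K S × CoupledState K S → ℝ≥0∞) p :=
          measurable_one.indicator hdiag.compl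
        rw [lintegral_add_left measurable_const, lintegral_const, measure_univ, mul_one]
        congr 1
        refine (Measure.lintegral_compProd (hi.comp measurable_fst)).trans ?_
        simp only [Function.comp, lintegral_const, measure_univ, mul_one]
        exact lintegral_indicator_one hdiag.compl

/-- The two index processes meet with exponential tails; up to a deterministic time the first
components stay in a ball, and afterwards they contract. -/
theorem wassersteinDist_coupledLaw_le (hf : IsRegularTarget f) (hκ : 0 < κ)
    (hconv : IsUniformlyStronglyConvex f κ) {R : ℝ} (hR0 : 0 ≤ R)
    (hR : ∀ y, ‖gradTheta f 0 y‖ ≤ κ * R) (hπ : V.IsUniqueInvariant π) {C δ : ℝ} (hC : 0 < C)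
    (hcoup : HasExponentialCoupling.{u, w} V π C δ) {ε : ℝ≥0} (hε : 0 < ε)
    (hεδ : 2 * κ * ε ≤ δ) {ρ : Measure (EuclideanSpace ℝ (Fin K) × S)}
    (hρ : IsStationaryMeasure V f ε ρ) (hρR : ∀ᵐ z ∂ρ, ‖z.1‖ ≤ R)
    (m : EuclideanSpace ℝ (Fin K)) (a : S) (t : ℝ≥0) :
    wassersteinDist (coupledLaw f ε t m (V.P a)) ρ ≤
      ENNReal.ofReal (Real.exp (-κ * (t / 2)) * (‖m‖ + 2 * R + C)) := by
  obtain ⟨hp, hs⟩ := (isStationaryMeasure_iff hf hconv).1 hρ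
  have hsnd := snd_eq_of_isStationaryMeasure hf hconv hπ hε hρ
  have hmk := isMarkovKernel_coupledKernel hf hconv V ε
  obtain ⟨Ω, mΩ, μ, ℱ, X, Y, hμ, hX, hY, hXl, hYl, hT, htail⟩ := hcoup a
  obtain ⟨Λ, hΛ, hΛ1, hΛ2, hΛd⟩ := exists_coupling_of_meetingTime hX hY hT (t / 2 / ε)
  have hev := CadlagPath.measurable_eval (S := S) (t / 2 / ε)
  have h1 : Λ.fst = (coupledKernel V f ε (t / 2) (m, a)).snd := by
    rw [hΛ1, coupledKernel_apply hf hconv, coupledLaw, Measure.snd,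
      Measure.map_map measurable_snd (measurable_coupled_right hf hconv ε _ m)]
    change _ = (V.P a).map (fun ω => ω (t / 2 / ε))
    rw [← hXl, Measure.map_map hev hX.measurable]
    rfl
  have h2 : Λ.snd = ρ.snd := by
    have e : μ.map (fun ω => Y ω (t / 2 / ε)) = (μ.map Y).map (fun ω => ω (t / 2 / ε)) := by
      rw [Measure.map_map hev hY.measurable]
      rfl
    rw [hΛ2, hsnd, e, hYl]
    refine Eq.trans ?_ (hπ.1.bind_eq (t / 2 / ε))
    refine Measure.ext_of_lintegral _ fun φ hφ => ?_
    have hc : Measurable fun ω : CadlagPath S => φ (ω (t / 2 / ε)) := hφ.comp hev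
    rw [lintegral_map hφ hev, FellerProcess.lawFrom,
      Measure.lintegral_bind V.P.aemeasurable hc.aemeasurable,
      Measure.lintegral_bind (V.measurable_transition _).aemeasurable hφ.aemeasurable]
    simp_rw [V.lintegral_transition _ _ hφ]
  -- Only the laws at time `t / 2` matter for the second half, so the coupling of the indices may be
  -- lifted to the full states without reference to the processes that produced it.
  obtain ⟨Γ, hΓ, hΓ1, hΓ2, hΓΛ⟩ := exists_coupling_over h1 h2
  have hD : ∀ᵐ p ∂Γ, ‖p.1.1 - p.2.1‖ ≤ ‖m‖ + 2 * R := by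
    have b1 := ae_norm_fst_coupledKernel_le hf hκ hconv hR0 hR V ε (t / 2) (m, a)
    have b2 := hρR
    rw [← hΓ1] at b1
    rw [← hΓ2] at b2
    filter_upwards [ae_of_ae_map measurable_fst.aemeasurable b1,
      ae_of_ae_map measurable_snd.aemeasurable b2] with p h1 h2
    refine (norm_sub_le _ _).trans ?_
    linarith
  have hW := wassersteinDist_bind_le hf hconv V ε (t / 2) Γ hD
  rw [hΓ1, hΓ2, hs, ← Kernel.comp_apply, ← coupledKernel_add hf hconv, add_halves,
    coupledKernel_apply hf hconv] at hW
  refine hW.trans ?_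
  have hne : Γ {p | p.1.2 ≠ p.2.2} ≤ ENNReal.ofReal (C * Real.exp (-κ * (t / 2))) := by
    have hdm : MeasurableSet {p : S × S | p.1 ≠ p.2} :=
      (measurableSet_eq_fun measurable_fst measurable_snd).compl
    have e : Γ {p | p.1.2 ≠ p.2.2} = Λ {p | p.1 ≠ p.2} := by
      rw [← hΓΛ, Measure.map_apply (by fun_prop) hdm]
      rfl
    rw [e]
    refine (hΛd.trans (htail _)).trans (ENNReal.ofReal_le_ofReal ?_)
    have hε' : (0 : ℝ) < ε := hε
    have ht : (0 : ℝ) ≤ t := t.coe_nonneg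
    gcongr C * Real.exp ?_
    push_cast
    -- Index time `t / 2 / ε` and `2κε ≤ δ` give the meeting tail the rate `κt`, more than the `κt /
    -- 2` needed to match the contraction over the second half.
    have h3 : 2 * κ * (t / 2) ≤ δ * (t / 2 / ε) := by
      rw [← mul_div_assoc δ, le_div_iff₀ hε']
      nlinarith
    nlinarith
  calc _ ≤ ENNReal.ofReal (Real.exp (-κ * (t / 2)) * (‖m‖ + 2 * R)) +
        ENNReal.ofReal (C * Real.exp (-κ * (t / 2))) := by
          refine add_le_add (le_of_eq ?_) hne
          push_cast
          rfl
    _ = _ := by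
        rw [← ENNReal.ofReal_add (by positivity) (by positivity)]
        congr 1
        ring

end Wasserstein

/-! ### Choice of the constant and conclusion. -/

theorem mainTheorem2 {K : ℕ} {S : Type u} [TopologicalSpace S] [PolishSpace S] [CompactSpace S]
    [MeasurableSpace S] [BorelSpace S]
    (f : EuclideanSpace ℝ (Fin K) → S → ℝ) (hf : IsRegularTarget f)
    (κ : ℝ) (hκ : 0 < κ) (hconv : IsUniformlyStronglyConvex f κ)
    (C : ℝ) (hC : 0 < C) :
    ∃ Cf : ℝ, 0 < Cf ∧
      ∀ (V : FellerProcess S) (π : Measure S), V.IsUniqueInvariant π →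
      ∀ δ : ℝ, 0 < δ → HasExponentialCoupling.{u, w} V π C δ →
      ∀ ε : ℝ≥0, 0 < ε → (ε : ℝ) ≤ min 1 (δ / (2 * κ)) →
      ∃ ρ : Measure (EuclideanSpace ℝ (Fin K) × S),
        IsStationaryMeasure V f ε ρ ∧
        (∀ ρ' : Measure (EuclideanSpace ℝ (Fin K) × S), IsStationaryMeasure V f ε ρ' → ρ' = ρ) ∧
        Integrable (fun z => ‖z.1‖ ^ 2) ρ ∧
        (∀ (m : EuclideanSpace ℝ (Fin K)) (a : S) (t : ℝ≥0),
          wassersteinDist (coupledLaw f ε t m (V.P a)) ρ ^ 2 ≤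
            ENNReal.ofReal (Cf * Real.exp (-κ * t) * ∫ z, (1 + ‖z.1 - m‖ ^ 2) ∂ρ)) ∧
        (∀ (m : EuclideanSpace ℝ (Fin K)) (t : ℝ≥0),
          wassersteinDist (coupledLaw f ε t m (V.lawFrom π)) ρ ^ 2 ≤
            ENNReal.ofReal (Cf * Real.exp (-κ * t) * ∫ z, ‖z.1 - m‖ ^ 2 ∂ρ)) := by
  obtain ⟨G, hG0, hG⟩ := hf.exists_norm_grad_le 0
  obtain ⟨R, hR0, hR⟩ : ∃ R : ℝ, 0 ≤ R ∧ ∀ y, ‖gradTheta f 0 y‖ ≤ κ * R :=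
    ⟨G / κ, by positivity, fun y => by rw [mul_div_cancel₀ _ hκ.ne']; exact hG y⟩
  -- On the support ball `‖m‖ + 2R + C ≤ a + b` with `a = 3R + C` and `b = ‖z.1 - m‖`, and `(a + b)²
  -- ≤ 2a² + 2b² ≤ (2a² + 2)(1 + b²)`. The radius `R` depends only on `f` and `κ`.
  refine ⟨2 * (3 * R + C) ^ 2 + 2, by positivity, ?_⟩
  intro V π hπ δ hδ hcoup ε hε hεle
  obtain ⟨ρ, hρ, hρR⟩ := exists_isStationaryMeasure hf hκ hconv hR0 hR hπ ε
  have := hρ.1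
  have hsnd := snd_eq_of_isStationaryMeasure hf hconv hπ hε hρ
  have hεδ : 2 * κ * ε ≤ δ := by
    have h := hεle.trans (min_le_right _ _)
    rw [le_div_iff₀ (by positivity)] at h
    linarith
  have hbd : ∀ m : EuclideanSpace ℝ (Fin K), ∀ᵐ z ∂ρ, ‖z.1 - m‖ ≤ R + ‖m‖ := fun m =>
    hρR.mono fun z hz => (norm_sub_le _ _).trans (by linarith)
  have hi1 : ∀ m : EuclideanSpace ℝ (Fin K), Integrable (fun z => ‖z.1 - m‖) ρ := fun m =>
    Integrable.of_bound (Measurable.aestronglyMeasurable (by fun_prop)) (R + ‖m‖)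
      ((hbd m).mono fun z hz => by rwa [norm_norm])
  have hi2 : ∀ m : EuclideanSpace ℝ (Fin K), Integrable (fun z => ‖z.1 - m‖ ^ 2) ρ := fun m =>
    Integrable.of_bound (Measurable.aestronglyMeasurable (by fun_prop)) ((R + ‖m‖) ^ 2)
      ((hbd m).mono fun z hz => by
        rw [norm_pow, norm_norm]
        gcongr)
  refine ⟨ρ, hρ, fun ρ' hρ' => hρ'.unique hf hκ hconv hπ hε hρ, by simpa using hi2 0, ?_, ?_⟩
  · intro m a t
    have hW := wassersteinDist_coupledLaw_le hf hκ hconv hR0 hR hπ hC hcoup hε hεδ hρ hρR m a t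
    have hconst : (‖m‖ + 2 * R + C) ^ 2 ≤
        (2 * (3 * R + C) ^ 2 + 2) * ∫ z, (1 + ‖z.1 - m‖ ^ 2) ∂ρ := by
      have hle : ∀ᵐ z ∂ρ, (‖m‖ + 2 * R + C) ^ 2 ≤
          (2 * (3 * R + C) ^ 2 + 2) * (1 + ‖z.1 - m‖ ^ 2) := by
        filter_upwards [hρR] with z hz
        have h1 : ‖m‖ ≤ R + ‖z.1 - m‖ := by
          calc ‖m‖ = ‖z.1 - (z.1 - m)‖ := by simp
            _ ≤ ‖z.1‖ + ‖z.1 - m‖ := norm_sub_le _ _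
            _ ≤ _ := by linarith
        have h2 : (‖m‖ + 2 * R + C) ^ 2 ≤ (3 * R + C + ‖z.1 - m‖) ^ 2 := by
          refine pow_le_pow_left₀ (by positivity) (by linarith) 2
        have h3 := sq_nonneg (3 * R + C - ‖z.1 - m‖)
        have h4 : 0 ≤ (3 * R + C) ^ 2 * ‖z.1 - m‖ ^ 2 := by positivity
        nlinarith
      have hint := integral_mono_ae (integrable_const _)
        (((integrable_const (1 : ℝ)).add (hi2 m)).const_mul (2 * (3 * R + C) ^ 2 + 2)) hle
      rw [integral_const_mul] at hint
      simpa using hint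
    calc wassersteinDist (coupledLaw f ε t m (V.P a)) ρ ^ 2
        ≤ ENNReal.ofReal (Real.exp (-κ * (t / 2)) * (‖m‖ + 2 * R + C)) ^ 2 :=
          pow_le_pow_left₀ zero_le hW 2
      _ = ENNReal.ofReal (Real.exp (-κ * t) * (‖m‖ + 2 * R + C) ^ 2) := by
          rw [← ENNReal.ofReal_pow (by positivity), mul_pow, ← Real.exp_nat_mul]
          congr 3
          push_cast
          ring
      _ ≤ _ := by
          refine ENNReal.ofReal_le_ofReal ?_
          rw [mul_comm (2 * (3 * R + C) ^ 2 + 2), mul_assoc]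
          exact mul_le_mul_of_nonneg_left hconst (Real.exp_pos _).le
  · intro m t
    have hW := wassersteinDist_lawFrom_le hf hconv hρ hsnd m t
    -- Jensen's inequality for the square, by integrating `(‖z.1 - m‖ - c)² ≥ 0` with `c` the mean.
    have hjensen : (∫ z, ‖z.1 - m‖ ∂ρ) ^ 2 ≤ ∫ z, ‖z.1 - m‖ ^ 2 ∂ρ := by
      set c := ∫ z, ‖z.1 - m‖ ∂ρ with hc
      have h1 : ∫ z, (2 * c * ‖z.1 - m‖ - c ^ 2) ∂ρ ≤ ∫ z, ‖z.1 - m‖ ^ 2 ∂ρ := by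
        refine integral_mono (((hi1 m).const_mul _).sub (integrable_const _)) (hi2 m) fun z => ?_
        have := sq_nonneg (‖z.1 - m‖ - c)
        simp only
        nlinarith
      rw [integral_sub ((hi1 m).const_mul _) (integrable_const _), integral_const_mul, ← hc] at h1
      simp only [integral_const, probReal_univ, one_smul] at h1
      nlinarith
    rw [← ofReal_integral_eq_lintegral_ofReal ((hi1 m).const_mul _)
      (Eventually.of_forall fun z => by positivity), integral_const_mul] at hW
    have hI : 0 ≤ ∫ z, ‖z.1 - m‖ ∂ρ := integral_nonneg fun z => norm_nonneg _
    calc wassersteinDist (coupledLaw f ε t m (V.lawFrom π)) ρ ^ 2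
        ≤ ENNReal.ofReal (Real.exp (-κ * t) * ∫ z, ‖z.1 - m‖ ∂ρ) ^ 2 :=
          pow_le_pow_left₀ zero_le hW 2
      _ = ENNReal.ofReal (Real.exp (-κ * t) ^ 2 * (∫ z, ‖z.1 - m‖ ∂ρ) ^ 2) := by
          rw [← ENNReal.ofReal_pow (by positivity), mul_pow]
      _ ≤ _ := by
          refine ENNReal.ofReal_le_ofReal (mul_le_mul ?_ hjensen (sq_nonneg _) (by positivity))
          -- The square of the contraction factor is `exp (-2κt)`, which is below `exp (-κt)`; the
          -- constant is at least `2`.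
          have h1 : Real.exp (-κ * t) ≤ 1 := by
            rw [Real.exp_le_one_iff]
            nlinarith [t.coe_nonneg]
          have h2 := Real.exp_pos (-κ * t)
          nlinarith [sq_nonneg (3 * R + C)]
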